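/- Let $P$ be an oriented planar link diagram with a distinguished marker on one of its edges; only the underlying projection (a plane graph with four-valent vertices, the crossings) and the marker play a role. The regions of $P$ are the connected components of its complement, and the two regions adjacent to the marker are called distinguished. A Kauffman state of $P$ chooses one of the four quadrants at each crossing in such a way that every region that is not distinguished contains exactly one chosen quadrant and the distinguished regions contain none. Two Kauffman states are connected by a clock move if there are exactly two crossings at which they differ and these two crossings are joined by a path of edges of $P$ none of which is adjacent to a distinguished region. A set $S$ of Kauffman states is clock-connected if any two elements of $S$ are joined by a finite sequence of clock moves, each of which connects two elements of $S$. Let $C$ be a set of crossings of $P$, all adjacent to one region $R$, which is one of the two distinguished regions. At each $c\in C$ label the four quadrants, in clockwise order, $N,E,S,W$ so that the quadrant labelled $S$ is contained in $R$. Let $P'$ be the diagram obtained from $P$ by resolving each $c\in C$ so that the $N$ and $S$ quadrants at $c$ become connected to one another. If $P'$ is connected, then the set of those Kauffman states of $P$ which, at each $c\in C$, occupy the $N$ or the $W$ quadrant is clock-connected. -/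

import Mathlib

universe u v

namespace PlanarClock

/-- The underlying combinatorial graph of a link projection, as a rotation system on the type `D`
of darts (half-edges). `next d` is the dart that follows `d` counterclockwise around the vertex of
`d`; `flip d` is the other half of the edge of `d`. The vertices are the orbits of `next`: an orbit
of four darts is a crossing, and an orbit of two darts is a regular point on a strand (for example
a basepoint; a closed component without crossings carries at least one such point). -/
structure Projection (D : Type u) where
  next : Equiv.Perm D
  flip : Equiv.Perm D
  next_four : ∀ d, next (next (next (next d))) = d
  next_ne : ∀ d, next d ≠ d
  flip_flip : ∀ d, flip (flip d) = d
  flip_ne : ∀ d, flip d ≠ d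

namespace Projection

variable {D : Type u} (P : Projection D)

/-- The vertices: cycles of the rotation. -/
abbrev Vertex : Type u := Quotient (Equiv.Perm.SameCycle.setoid P.next)

/-- The vertex from which a dart emanates. -/
def vertex (d : D) : P.Vertex := Quotient.mk _ d

/-- A vertex is a crossing when it has valence four (and not two). -/
def IsCrossing (w : P.Vertex) : Prop := ∀ d, P.vertex d = w → P.next (P.next d) ≠ d

abbrev Crossing : Type u := {w : P.Vertex // P.IsCrossing w}

/-- The edges. -/
abbrev Edge : Type u := Quotient (Equiv.Perm.SameCycle.setoid P.flip)

/-- The successor of a dart on the boundary of the face to its left. -/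
def faceNext : Equiv.Perm D := P.flip.trans P.next.symm

/-- The faces: boundary cycles of the complementary regions. -/
abbrev Face : Type u := Quotient (Equiv.Perm.SameCycle.setoid P.faceNext)

/-- The connected components of the graph. -/
abbrev Component : Type u :=
  MulAction.orbitRel.Quotient (Subgroup.closure {P.next, P.flip} : Subgroup (Equiv.Perm D)) D

/-- The projection, as a subset of the plane, is connected. -/
def Connected : Prop := Nonempty D ∧ Subsingleton P.Component

end Projection

/-- A planar (spherical) diagram, possibly disconnected, with one distinguished marked edge.
The type `Region` is that of the connected components of the complement of the diagram, and
`region d` is the region on the left of `d` (the one that contains the quadrant between `d` and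
`next d`). Each component of the diagram is embedded in a sphere (`euler`), and the graph whose
vertices are the components of the diagram and the regions, and whose edges are the faces, is
connected (`incidence`) with one vertex more than edges (`tree`), that is, a tree. For a connected
diagram the regions are thus precisely the faces. -/
structure MarkedDiagram (D : Type u) (Region : Type v) extends Projection D where
  region : D → Region
  region_surjective : Function.Surjective region
  region_faceNext : ∀ d, region (toProjection.faceNext d) = region d
  euler : Nat.card toProjection.Vertex + Nat.card toProjection.Face
    = Nat.card toProjection.Edge + 2 * Nat.card toProjection.Component
  incidence : ∀ d e : D, Relation.EqvGen
    (fun a b => b = next a ∨ b = flip a ∨ region a = region b) d e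
  tree : Nat.card toProjection.Component + Nat.card Region = Nat.card toProjection.Face + 1
  /-- a dart of the edge that carries the distinguished marker -/
  mark : D

namespace MarkedDiagram

variable {D : Type u} {Region : Type v} (P : MarkedDiagram D Region)

/-- The two distinguished regions are those on the two sides of the distinguished marker. -/
def Distinguished (r : Region) : Prop := r = P.region P.mark ∨ r = P.region (P.flip P.mark)

/-- A Kauffman state: a choice of one of the four quadrants at each crossing, such that every
region that is not distinguished contains exactly one chosen quadrant, and the distinguished
regions contain none. The quadrant between `d` and `next d` is recorded as `d`. -/
structure KauffmanState where
  quadrant : P.Crossing → D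
  vertex_quadrant : ∀ c, P.vertex (quadrant c) = c.1
  bijOn : Set.BijOn (fun c => P.region (quadrant c)) Set.univ {r | ¬ P.Distinguished r}

/-- `a` and `b` are the endpoints of an edge neither side of which is a distinguished region. -/
def FreeEdge (a b : P.Vertex) : Prop :=
  ∃ d : D, P.vertex d = a ∧ P.vertex (P.flip d) = b ∧
    ¬ P.Distinguished (P.region d) ∧ ¬ P.Distinguished (P.region (P.flip d))

variable {P}

/-- Two Kauffman states are connected by a clock move: they differ at exactly two crossings, and
these are joined by a path of edges that are not adjacent to a distinguished region. -/
def ClockMove (x y : P.KauffmanState) : Prop :=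
  ∃ c₁ c₂ : P.Crossing, c₁ ≠ c₂ ∧
    x.quadrant c₁ ≠ y.quadrant c₁ ∧ x.quadrant c₂ ≠ y.quadrant c₂ ∧
    (∀ c, c ≠ c₁ → c ≠ c₂ → x.quadrant c = y.quadrant c) ∧
    Relation.ReflTransGen P.FreeEdge c₁.1 c₂.1

/-- Any two elements of `S` are joined by a sequence of clock moves, each of which connects two
elements of `S`. -/
def ClockConnected (S : Set P.KauffmanState) : Prop :=
  ∀ x ∈ S, ∀ y ∈ S, Relation.ReflTransGen (fun a b => a ∈ S ∧ b ∈ S ∧ ClockMove a b) x y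

end MarkedDiagram

namespace Projection

variable {D : Type u} (P : Projection D)

/-- A labelling of the four quadrants at each crossing of `C` by the points of the compass; it is
determined by the quadrant labelled `S`. -/
structure Labelling (C : Set P.Crossing) where
  south : C → D
  vertex_south : ∀ c, P.vertex (south c) = c.1.1

namespace Labelling

variable {P} {C : Set P.Crossing} (L : P.Labelling C)

/- Counterclockwise from `S` one meets `E`, `N`, `W`. -/
def east (c : C) : D := P.next (L.south c)
def north (c : C) : D := P.next (P.next (L.south c))
def west (c : C) : D := P.next (P.next (P.next (L.south c)))

/-- `d` is a dart at a crossing of `C` such that the quadrant between `d` and `next d` is labelled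
`N` or `S`. The other darts at such a crossing are those followed by an `E` or `W` quadrant. -/
def IsNS (d : D) : Prop := ∃ c : C, d = L.south c ∨ d = L.north c

theorem isNS_next_next {d : D} (h : L.IsNS d) : L.IsNS (P.next (P.next d)) := by
  obtain ⟨c, rfl | rfl⟩ := h
  · exact ⟨c, Or.inr rfl⟩
  · exact ⟨c, Or.inl (by simp only [north, P.next_four])⟩

theorem vertex_next (d : D) : P.vertex (P.next d) = P.vertex d :=
  Quotient.sound (s := Equiv.Perm.SameCycle.setoid P.next)
    (Equiv.Perm.sameCycle_apply_left.2 (Equiv.Perm.SameCycle.refl _ _))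

theorem not_isNS_next {d : D} (h : L.IsNS d) : ¬ L.IsNS (P.next d) := by
  rintro ⟨c', h'⟩
  obtain ⟨c, h⟩ := h
  have key : c = c' := by
    apply Subtype.ext
    apply Subtype.ext
    rw [← L.vertex_south c, ← L.vertex_south c']
    have h1 : P.vertex d = P.vertex (L.south c) := by
      rcases h with rfl | rfl <;> simp [north, vertex_next]
    have h2 : P.vertex (P.next d) = P.vertex (L.south c') := by
      rcases h' with h' | h' <;> rw [h'] <;> simp [north, vertex_next]
    exact h1.symm.trans ((vertex_next d).symm.trans h2)
  subst key
  have e1 := P.next_ne (L.south c)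
  have e2 := P.next_ne (P.next (L.south c))
  have e3 := P.next_ne (P.next (P.next (P.next (L.south c))))
  rw [P.next_four] at e3
  unfold north at h h'
  rcases h with rfl | rfl <;> rcases h' with h' | h'
  · exact e1 h'
  · exact e2 h'.symm
  · exact e3 h'.symm
  · exact e2 (P.next.injective h')

open Classical in
/-- The rotation of the `NS` resolution: at a crossing of `C` the two darts that bound the `W`
quadrant become the two ends of one strand, and so do the two that bound the `E` quadrant. -/
noncomputable def resolvedNext (d : D) : D := if L.IsNS d then P.next.symm d else P.next d

theorem isNS_symm_symm {d : D} (h : L.IsNS d) : L.IsNS (P.next.symm (P.next.symm d)) := by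
  have h' := L.isNS_next_next h
  rwa [show P.next (P.next d) = P.next.symm (P.next.symm d) by
    rw [Equiv.eq_symm_apply, Equiv.eq_symm_apply, P.next_four]] at h'

theorem not_isNS_symm {d : D} (h : L.IsNS d) : ¬ L.IsNS (P.next.symm d) := fun h' =>
  L.not_isNS_next h' (by simpa using h)

theorem resolvedNext_of_isNS {d : D} (h : L.IsNS d) :
    L.resolvedNext d = P.next.symm d := if_pos h

theorem resolvedNext_of_not {d : D} (h : ¬ L.IsNS d) : L.resolvedNext d = P.next d := if_neg h

theorem resolvedNext_injective : Function.Injective L.resolvedNext := by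
  have aux : ∀ a b, L.IsNS a → ¬ L.IsNS b → P.next.symm a = P.next b → False := by
    intro a b ha hb h
    apply hb
    have := L.isNS_symm_symm ha
    rwa [h, Equiv.symm_apply_apply] at this
  intro a b h
  by_cases ha : L.IsNS a <;> by_cases hb : L.IsNS b
  · rw [L.resolvedNext_of_isNS ha, L.resolvedNext_of_isNS hb] at h
    exact P.next.symm.injective h
  · rw [L.resolvedNext_of_isNS ha, L.resolvedNext_of_not hb] at h
    exact (aux a b ha hb h).elim
  · rw [L.resolvedNext_of_not ha, L.resolvedNext_of_isNS hb] at h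
    exact (aux b a hb ha h.symm).elim
  · rw [L.resolvedNext_of_not ha, L.resolvedNext_of_not hb] at h
    exact P.next.injective h

theorem resolvedNext_ne (d : D) : L.resolvedNext d ≠ d := by
  by_cases h : L.IsNS d
  · rw [L.resolvedNext_of_isNS h, Ne, Equiv.symm_apply_eq]
    exact (P.next_ne d).symm
  · rw [L.resolvedNext_of_not h]
    exact P.next_ne d

theorem resolvedNext_four (d : D) :
    L.resolvedNext (L.resolvedNext (L.resolvedNext (L.resolvedNext d))) = d := by
  have two : ∀ a, L.IsNS a → L.resolvedNext (L.resolvedNext a) = a := by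
    intro a ha
    rw [L.resolvedNext_of_isNS ha, L.resolvedNext_of_not (L.not_isNS_symm ha),
      Equiv.apply_symm_apply]
  have two' : ∀ a, L.IsNS (P.next a) → L.resolvedNext (L.resolvedNext a) = a := by
    intro a ha
    have hna : ¬ L.IsNS a := fun h => L.not_isNS_next h ha
    rw [L.resolvedNext_of_not hna, L.resolvedNext_of_isNS ha, Equiv.symm_apply_apply]
  by_cases h : L.IsNS d
  · rw [two d h, two d h]
  by_cases h1 : L.IsNS (P.next d)
  · rw [two' d h1, two' d h1]
  have h2 : ¬ L.IsNS (P.next (P.next d)) := fun h' =>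
    h (by simpa only [P.next_four] using L.isNS_next_next h')
  have h3 : ¬ L.IsNS (P.next (P.next (P.next d))) := fun h' =>
    h1 (by simpa only [P.next_four] using L.isNS_next_next h')
  rw [L.resolvedNext_of_not h, L.resolvedNext_of_not h1, L.resolvedNext_of_not h2,
    L.resolvedNext_of_not h3, P.next_four]

theorem resolvedNext_surjective : Function.Surjective L.resolvedNext := fun d =>
  ⟨_, L.resolvedNext_four d⟩

/-- The `NS` resolution at every crossing of `C`: the regions `N` and `S` are joined there. -/
noncomputable def nsResolution : Projection D where
  next := Equiv.ofBijective L.resolvedNext ⟨L.resolvedNext_injective, L.resolvedNext_surjective⟩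
  flip := P.flip
  next_four := L.resolvedNext_four
  next_ne := L.resolvedNext_ne
  flip_flip := P.flip_flip
  flip_ne := P.flip_ne

end Labelling

end Projection

/-- The Kauffman states of type `C`-NW. -/
def MarkedDiagram.typeNW {D : Type u} {Region : Type v} {P : MarkedDiagram D Region}
    {C : Set P.Crossing} (L : P.toProjection.Labelling C) : Set P.KauffmanState :=
  {x | ∀ c : C, x.quadrant c = L.north c ∨ x.quadrant c = L.west c}

end PlanarClock

/-! Overlay the diagram with the bipartite graph whose nodes are the vertices and the regions and
whose edges are the quadrants; its faces correspond to the edges of `P`. For connected `P` this is a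
cell structure on the sphere, so a function on quadrants orthogonal to all coboundaries from one
side is a coboundary from the other (`exists_potential`). In particular, two states differ by the
coboundary of a height function on the edges of `P` (`exists_height`), and rotating chosen quadrants
counterclockwise lowers this height.

Lowering strictly decreases a well-founded relation on the finite set of states. A state that cannot
be lowered is unique: otherwise the edges on which it is highest relative to another state would
form a lowerable set (`height_le_mark`, `eq_of_not_isLowerable`). Hence a set of states is
clock-connected once lowering steps that are clock moves keep it invariant
(`clockConnected_of_lower_mem`).

The hard point is that a lowering along a minimal lowerable set `V`, with its holes filled, changes
exactly two crossings (`IsMinimalLowerable.ncard_isEntry`). This follows from Euler-type counts on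
the filled set and on its complement, once the filled set is known to have just one dart at each
crossing where it is entered. That local shape rests on `IsMinimalLowerable.used_of_outside`:
minimality turns a bad quadrant into a circulation, and the potential of this circulation
contradicts the fact that every cell is `accessible` from the distinguished regions.

For type NW, a lowering may turn `N` into `W`, but never `W` into `S`: the edge crossed would border
the distinguished region `R`, where nothing is lowered (`IsMinimalLowerable.lower_mem_typeNW`). The
connected resolution enters through the connectedness of `P`. -/

namespace PlanarClock

/-! ### Euler's formula as rational linear algebra -/

section Cells

variable {I Q J : Type*}

/-- The coboundary of a function on cells, for a pair of end maps. -/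
def diffMap (a a' : Q → I) : (I → ℚ) →ₗ[ℚ] (Q → ℚ) :=
  LinearMap.funLeft ℚ ℚ a - LinearMap.funLeft ℚ ℚ a'

@[simp]
theorem diffMap_apply (a a' : Q → I) (w : I → ℚ) (q : Q) :
    diffMap a a' w q = w (a q) - w (a' q) := rfl

theorem disjoint_of_dotProduct_eq_zero [Fintype Q] {R₁ R₂ : Submodule ℚ (Q → ℚ)}
    (h : ∀ f ∈ R₁, ∀ g ∈ R₂, ∑ q, f q * g q = 0) : Disjoint R₁ R₂ := by
  rw [Submodule.disjoint_def]
  intro f h₁ h₂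
  have h₀ := h f h₁ f h₂
  rw [Finset.sum_eq_zero_iff_of_nonneg fun q _ => mul_self_nonneg _] at h₀
  ext q
  simpa using h₀ q (Finset.mem_univ q)

theorem finrank_le_one_of_const [Finite I] {N : Submodule ℚ (I → ℚ)}
    (h : ∀ w ∈ N, ∀ i i', w i = w i') : Module.finrank ℚ N ≤ 1 := by
  have : N ≤ Submodule.span ℚ {fun _ : I => (1 : ℚ)} := by
    intro w hw
    rw [Submodule.mem_span_singleton]
    rcases isEmpty_or_nonempty I with hI | ⟨⟨i⟩⟩
    · exact ⟨0, Subsingleton.elim _ _⟩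
    · exact ⟨w i, by ext j; simp [h w hw i j]⟩
  refine (Submodule.finrank_mono this).trans ?_
  exact (finrank_span_le_card _).trans (by simp)

/-- The two coboundary spaces are orthogonal and have ranks at least `|I| - 1` and `|J| - 1`, so the
Euler relation `hcard` makes them span everything. The part of `f` in the first space is orthogonal
to itself, hence zero by positivity over `ℚ`. -/
theorem exists_potential [Finite I] [Fintype Q] [Finite J] (a a' : Q → I) (b b' : Q → J)
    (horth : ∀ (w : I → ℚ) (h : J → ℚ), ∑ q, (w (a q) - w (a' q)) * (h (b q) - h (b' q)) = 0)
    (ha : ∀ w : I → ℚ, (∀ q, w (a q) = w (a' q)) → ∀ i i', w i = w i')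
    (hb : ∀ h : J → ℚ, (∀ q, h (b q) = h (b' q)) → ∀ j j', h j = h j')
    (hcard : Nat.card I + Nat.card J = Nat.card Q + 2)
    (f : Q → ℚ) (hf : ∀ w : I → ℚ, ∑ q, (w (a q) - w (a' q)) * f q = 0) :
    ∃ h : J → ℚ, ∀ q, h (b q) - h (b' q) = f q := by
  have := Fintype.ofFinite I
  have := Fintype.ofFinite J
  have hdisj : Disjoint (LinearMap.range (diffMap a a')) (LinearMap.range (diffMap b b')) := by
    apply disjoint_of_dotProduct_eq_zero
    rintro _ ⟨w, rfl⟩ _ ⟨h, rfl⟩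
    exact horth w h
  have kα : Module.finrank ℚ (LinearMap.ker (diffMap a a')) ≤ 1 :=
    finrank_le_one_of_const fun w hw => ha w fun q => sub_eq_zero.1 (congrFun hw q)
  have kβ : Module.finrank ℚ (LinearMap.ker (diffMap b b')) ≤ 1 :=
    finrank_le_one_of_const fun w hw => hb w fun q => sub_eq_zero.1 (congrFun hw q)
  have rα := LinearMap.finrank_range_add_finrank_ker (diffMap a a')
  have rβ := LinearMap.finrank_range_add_finrank_ker (diffMap b b')
  have hs := Submodule.finrank_sup_add_finrank_inf_eq (LinearMap.range (diffMap a a'))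
    (LinearMap.range (diffMap b b'))
  rw [hdisj.eq_bot, finrank_bot] at hs
  simp only [Nat.card_eq_fintype_card] at hcard
  rw [Module.finrank_fintype_fun_eq_card] at rα rβ
  have htop : LinearMap.range (diffMap a a') ⊔ LinearMap.range (diffMap b b') = ⊤ := by
    apply Submodule.eq_top_of_finrank_eq
    have := Submodule.finrank_le (LinearMap.range (diffMap a a') ⊔ LinearMap.range (diffMap b b'))
    rw [Module.finrank_fintype_fun_eq_card] at this ⊢
    omega
  have hmem : f ∈ LinearMap.range (diffMap a a') ⊔ LinearMap.range (diffMap b b') :=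
    htop ▸ Submodule.mem_top
  obtain ⟨_, ⟨w, rfl⟩, _, ⟨h, rfl⟩, rfl⟩ := Submodule.mem_sup.1 hmem
  have h₀ : ∑ q, (w (a q) - w (a' q)) * (w (a q) - w (a' q)) = 0 := by
    have := hf w
    simp only [Pi.add_apply, diffMap_apply, mul_add, Finset.sum_add_distrib, horth,
      add_zero] at this
    exact this
  rw [Finset.sum_eq_zero_iff_of_nonneg fun q _ => mul_self_nonneg _] at h₀
  refine ⟨h, fun q => ?_⟩
  have := mul_self_eq_zero.1 (h₀ q (Finset.mem_univ q))
  simp [this]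

/-- The 1-cells with an end in `S`. -/
def touching (a a' : Q → I) (S : Set I) : Set Q := {q | a q ∈ S ∨ a' q ∈ S}

/-- The dual cells incident with a 1-cell that has an end in `S`. -/
def dualTouching (a a' : Q → I) (b b' : Q → J) (S : Set I) : Set J :=
  {j | ∃ q ∈ touching a a' S, j = b q ∨ j = b' q}

/-- A local Euler inequality. Functions supported on `S` have coboundaries supported on the touching
1-cells, so orthogonality survives restriction to these. There one coboundary map is injective by
`hS`, the other has kernel of dimension at most one by `hJ`, and the ranks add up to at most the
number of touching 1-cells. -/
theorem ncard_add_ncard_le [Finite I] [Fintype Q] [Finite J] (a a' : Q → I) (b b' : Q → J)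
    (horth : ∀ (w : I → ℚ) (h : J → ℚ), ∑ q, (w (a q) - w (a' q)) * (h (b q) - h (b' q)) = 0)
    (S : Set I)
    (hS : ∀ w : I → ℚ, (∀ i, i ∉ S → w i = 0) → (∀ q, w (a q) = w (a' q)) → ∀ i, w i = 0)
    (hJ : ∀ h : J → ℚ, (∀ q ∈ touching a a' S, h (b q) = h (b' q)) →
      ∀ j ∈ dualTouching a a' b b' S, ∀ j' ∈ dualTouching a a' b b' S, h j = h j') :
    S.ncard + (dualTouching a a' b b' S).ncard ≤ (touching a a' S).ncard + 1 := by
  classical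
  have := Fintype.ofFinite I
  have := Fintype.ofFinite J
  let T := touching a a' S
  let U := dualTouching a a' b b' S
  let ext₁ (w : S → ℚ) : I → ℚ := fun i => if h : i ∈ S then w ⟨i, h⟩ else 0
  let ext₂ (w : U → ℚ) : J → ℚ := fun i => if h : i ∈ U then w ⟨i, h⟩ else 0
  let E₁ : (S → ℚ) →ₗ[ℚ] (I → ℚ) :=
    { toFun := ext₁
      map_add' := fun w w' => by ext i; by_cases h : i ∈ S <;> simp [ext₁, h]
      map_smul' := fun c w => by ext i; by_cases h : i ∈ S <;> simp [ext₁, h] }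
  let E₂ : (U → ℚ) →ₗ[ℚ] (J → ℚ) :=
    { toFun := ext₂
      map_add' := fun w w' => by ext i; by_cases h : i ∈ U <;> simp [ext₂, h]
      map_smul' := fun c w => by ext i; by_cases h : i ∈ U <;> simp [ext₂, h] }
  let α : (S → ℚ) →ₗ[ℚ] (T → ℚ) :=
    LinearMap.funLeft ℚ ℚ (Subtype.val : T → Q) ∘ₗ diffMap a a' ∘ₗ E₁
  let β : (U → ℚ) →ₗ[ℚ] (T → ℚ) :=
    LinearMap.funLeft ℚ ℚ (Subtype.val : T → Q) ∘ₗ diffMap b b' ∘ₗ E₂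
  have off : ∀ w q, q ∉ T → ext₁ w (a q) - ext₁ w (a' q) = 0 := by
    intro w q hq
    have hq' : ¬ (a q ∈ S ∨ a' q ∈ S) := hq
    push Not at hq'
    simp [ext₁, hq'.1, hq'.2]
  have hdisj : Disjoint (LinearMap.range α) (LinearMap.range β) := by
    apply disjoint_of_dotProduct_eq_zero
    rintro _ ⟨w, rfl⟩ _ ⟨h, rfl⟩
    have key := horth (ext₁ w) (ext₂ h)
    rw [← Finset.sum_subset (Finset.subset_univ (Finset.univ.filter fun q => q ∈ T))
      fun q _ hq => by rw [off w q (by simpa using hq), zero_mul],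
      Finset.sum_subtype (p := fun q => q ∈ T) _ (by simp)] at key
    exact key
  have kα : Module.finrank ℚ (LinearMap.ker α) = 0 := by
    rw [Submodule.finrank_eq_zero, LinearMap.ker_eq_bot']
    intro w hw
    have h0 : ∀ i, ext₁ w i = 0 := by
      apply hS
      · intro i hi
        simp [ext₁, hi]
      · intro q
        by_cases hq : q ∈ T
        · exact sub_eq_zero.1 (congrFun hw ⟨q, hq⟩)
        · exact sub_eq_zero.1 (off w q hq)
    ext i
    simpa [ext₁] using h0 i
  have kβ : Module.finrank ℚ (LinearMap.ker β) ≤ 1 := by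
    apply finrank_le_one_of_const
    intro w hw i i'
    have := hJ (ext₂ w) (fun q hq => sub_eq_zero.1 (congrFun hw ⟨q, hq⟩)) i i.2 i' i'.2
    have e : ∀ i : U, ext₂ w i = w i := fun i => by simp [ext₂]
    rw [e, e] at this
    exact this
  have rα := LinearMap.finrank_range_add_finrank_ker α
  have rβ := LinearMap.finrank_range_add_finrank_ker β
  have hs := Submodule.finrank_add_finrank_le_of_disjoint hdisj
  rw [Module.finrank_fintype_fun_eq_card] at rα rβ hs
  rw [← Nat.card_coe_set_eq, ← Nat.card_coe_set_eq, ← Nat.card_coe_set_eq]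
  simp only [Nat.card_eq_fintype_card]
  change Fintype.card S + Fintype.card U ≤ Fintype.card T + 1
  omega

end Cells

/-! ### Orbits, connectedness and sums over darts -/

namespace Projection

variable {D : Type u} (P : Projection D)

def edge (d : D) : P.Edge := Quotient.mk _ d

variable {P}

/-- Allowing `φ` to be `Prop`-valued makes this, and the variants below, serve as induction along an
orbit. -/
theorem map_eq_of_sameCycle {α β : Type*} {π : Equiv.Perm α} {φ : α → β}
    (h : ∀ a, φ (π a) = φ a) {a b : α} (hab : π.SameCycle a b) : φ a = φ b := by
  obtain ⟨n, rfl⟩ := hab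
  induction n using Int.induction_on generalizing a with
  | zero => simp
  | succ n ih => rw [zpow_add_one, Equiv.Perm.mul_apply, ← ih, h]
  | pred n ih =>
    rw [sub_eq_add_neg, zpow_add, Equiv.Perm.mul_apply, ← ih, zpow_neg_one, ← h (π⁻¹ a)]
    exact (congrArg φ (π.apply_symm_apply a)).symm

theorem map_eq_of_vertex_eq {β : Type*} {φ : D → β} (h : ∀ d, φ (P.next d) = φ d) {a b : D}
    (hab : P.vertex a = P.vertex b) : φ a = φ b :=
  map_eq_of_sameCycle h (Quotient.exact hab)

theorem map_eq_of_edge_eq {β : Type*} {φ : D → β} (h : ∀ d, φ (P.flip d) = φ d) {a b : D}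
    (hab : P.edge a = P.edge b) : φ a = φ b :=
  map_eq_of_sameCycle h (Quotient.exact hab)

@[simp]
theorem vertex_next (d : D) : P.vertex (P.next d) = P.vertex d :=
  Labelling.vertex_next d

@[simp]
theorem edge_flip (d : D) : P.edge (P.flip d) = P.edge d :=
  Quotient.sound (s := Equiv.Perm.SameCycle.setoid P.flip)
    (Equiv.Perm.sameCycle_apply_left.2 (Equiv.Perm.SameCycle.refl _ _))

theorem vertex_surjective : Function.Surjective P.vertex := Quotient.mk_surjective

theorem edge_surjective : Function.Surjective P.edge := Quotient.mk_surjective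

theorem eq_of_vertex_eq {d d' : D} (h : P.vertex d' = P.vertex d) :
    d' = d ∨ d' = P.next d ∨ d' = P.next (P.next d) ∨ d' = P.next (P.next (P.next d)) := by
  have key := map_eq_of_vertex_eq (P := P) (φ := fun e => e = d ∨ e = P.next d ∨
    e = P.next (P.next d) ∨ e = P.next (P.next (P.next d))) ?_ h
  · simp only at key
    rw [key]
    exact Or.inl trivial
  · intro e
    apply propext
    simp only [Equiv.apply_eq_iff_eq]
    have h4 : P.next e = d ↔ e = P.next (P.next (P.next d)) := by
      constructor
      · rintro rfl
        exact (P.next_four _).symm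
      · rintro rfl
        exact P.next_four _
    rw [h4]
    tauto

theorem eq_of_edge_eq {d d' : D} (h : P.edge d' = P.edge d) : d' = d ∨ d' = P.flip d := by
  have key := map_eq_of_edge_eq (P := P) (φ := fun e => e = d ∨ e = P.flip d) ?_ h
  · simp only at key
    rw [key]
    exact Or.inl trivial
  · intro e
    apply propext
    simp only [Equiv.apply_eq_iff_eq]
    have h4 : P.flip e = d ↔ e = P.flip d := by
      constructor
      · rintro rfl
        exact (P.flip_flip _).symm
      · rintro rfl
        exact P.flip_flip _
    rw [h4]
    tauto

@[simp]
theorem next_faceNext (d : D) : P.next (P.faceNext d) = P.flip d := by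
  simp [faceNext]

@[simp]
theorem vertex_faceNext (d : D) : P.vertex (P.faceNext d) = P.vertex (P.flip d) := by
  rw [← vertex_next, next_faceNext]

theorem faceNext_flip_next (d : D) : P.faceNext (P.flip (P.next d)) = d := by
  simp [faceNext, P.flip_flip]

theorem Connected.map_eq (hP : P.Connected) {β : Type*} {φ : D → β}
    (h₁ : ∀ d, φ (P.next d) = φ d) (h₂ : ∀ d, φ (P.flip d) = φ d) (a b : D) : φ a = φ b := by
  have := hP.2
  have hab : (Quotient.mk _ a : P.Component) = Quotient.mk _ b := Subsingleton.elim _ _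
  obtain ⟨⟨g, hg⟩, rfl⟩ := Quotient.exact hab
  change φ (g b) = φ b
  clear hab
  induction hg using Subgroup.closure_induction generalizing b with
  | mem x hx =>
    rcases hx with rfl | rfl
    · exact h₁ b
    · exact h₂ b
  | one => rfl
  | mul x y _ _ ihx ihy => rw [Equiv.Perm.mul_apply, ihx, ihy]
  | inv x _ ih => exact (ih _).symm.trans (congrArg φ (x.apply_symm_apply b))

theorem connected_of_map_eq [Nonempty D]
    (h : ∀ φ : D → Prop, (∀ d, φ (P.next d) = φ d) → (∀ d, φ (P.flip d) = φ d) →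
      ∀ a b, φ a = φ b) : P.Connected := by
  refine ⟨inferInstance, ⟨?_⟩⟩
  intro x y
  induction x using Quotient.inductionOn with | _ a
  induction y using Quotient.inductionOn with | _ b
  have inv : ∀ π ∈ ({P.next, P.flip} : Set (Equiv.Perm D)), ∀ d,
      (Quotient.mk _ (π d) : P.Component) = Quotient.mk _ d := fun π hπ d =>
    Quotient.sound ⟨⟨π, Subgroup.subset_closure hπ⟩, rfl⟩
  have := h (fun d => (Quotient.mk _ d : P.Component) = Quotient.mk _ b)
    (fun d => by rw [inv _ (Or.inl rfl)]) (fun d => by rw [inv _ (Or.inr rfl)]) a b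
  simpa using this

/-- The resolved rotation only permutes darts within a vertex of `P`, so invariants of `P` are
invariants of the resolution. -/
theorem Labelling.connected_of_nsResolution {C : Set P.Crossing} (L : P.Labelling C)
    (h : L.nsResolution.Connected) : P.Connected := by
  have := h.1
  apply connected_of_map_eq
  intro φ h₁ h₂
  refine h.map_eq (φ := φ) (fun d => ?_) h₂
  change φ (L.resolvedNext d) = φ d
  by_cases hd : L.IsNS d
  · rw [L.resolvedNext_of_isNS hd, ← h₁, Equiv.apply_symm_apply]
  · rw [L.resolvedNext_of_not hd, h₁]

theorem sum_edge [Fintype D] [Fintype P.Edge] {M : Type*} [AddCommMonoid M] (g : P.Edge → M) :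
    ∑ d, g (P.edge d) = ∑ e, (g e + g e) := by
  classical
  rw [← Finset.sum_fiberwise_of_maps_to (s := Finset.univ) (t := Finset.univ) (g := P.edge)
    fun _ _ => Finset.mem_univ _]
  refine Finset.sum_congr rfl fun e _ => ?_
  obtain ⟨d, rfl⟩ := P.edge_surjective e
  have : (Finset.univ.filter fun d' => P.edge d' = P.edge d) = {d, P.flip d} := by
    ext d'
    simp only [Finset.mem_filter, Finset.mem_univ, true_and, Finset.mem_insert,
      Finset.mem_singleton]
    refine ⟨eq_of_edge_eq, ?_⟩
    rintro (rfl | rfl) <;> simp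
  rw [this, Finset.sum_pair (P.flip_ne d).symm, edge_flip]

theorem card_dart [Finite D] : Nat.card D = 2 * Nat.card P.Edge := by
  classical
  have := Fintype.ofFinite D
  have := Fintype.ofFinite P.Edge
  have h := P.sum_edge (fun _ => 1)
  simp only [Finset.sum_const, Finset.card_univ, smul_eq_mul, mul_one] at h
  simp only [Nat.card_eq_fintype_card]
  omega

theorem sum_vertex_of_isCrossing [Fintype D] [DecidableEq P.Vertex] {M : Type*}
    [AddCommMonoid M] (F : D → M) {d : D} (hd : P.IsCrossing (P.vertex d)) :
    ∑ d' with P.vertex d' = P.vertex d, F d' =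
      F d + (F (P.next d) + (F (P.next (P.next d)) + F (P.next (P.next (P.next d))))) := by
  classical
  have e1 := P.next_ne
  have e2 : ∀ d', P.vertex d' = P.vertex d → P.next (P.next d') ≠ d' := hd
  have e3 : P.next (P.next (P.next d)) ≠ d := fun h => P.next_ne d (by
    conv_rhs => rw [← P.next_four d, h])
  have : (Finset.univ.filter fun d' => P.vertex d' = P.vertex d) =
      {d, P.next d, P.next (P.next d), P.next (P.next (P.next d))} := by
    ext d'
    simp only [Finset.mem_filter, Finset.mem_univ, true_and, Finset.mem_insert,
      Finset.mem_singleton]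
    refine ⟨eq_of_vertex_eq, ?_⟩
    rintro (rfl | rfl | rfl | rfl) <;> simp
  rw [this, Finset.sum_insert, Finset.sum_insert, Finset.sum_pair (e1 _).symm]
  · simp only [Finset.mem_insert, Finset.mem_singleton, not_or]
    exact ⟨(e1 _).symm, (e2 _ (by simp)).symm⟩
  · simp only [Finset.mem_insert, Finset.mem_singleton, not_or]
    exact ⟨(e1 _).symm, (e2 _ rfl).symm, e3.symm⟩

theorem next_next_of_not_isCrossing {d : D} (hd : ¬ P.IsCrossing (P.vertex d)) :
    P.next (P.next d) = d := by
  simp only [IsCrossing, not_forall, ne_eq, not_not] at hd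
  obtain ⟨d', h, h'⟩ := hd
  rcases eq_of_vertex_eq h.symm with rfl | rfl | rfl | rfl <;> simp only [h']

theorem sum_vertex_of_not_isCrossing [Fintype D] [DecidableEq P.Vertex] {M : Type*}
    [AddCommMonoid M] (F : D → M) {d : D} (hd : ¬ P.IsCrossing (P.vertex d)) :
    ∑ d' with P.vertex d' = P.vertex d, F d' = F d + F (P.next d) := by
  classical
  have : (Finset.univ.filter fun d' => P.vertex d' = P.vertex d) = {d, P.next d} := by
    ext d'
    simp only [Finset.mem_filter, Finset.mem_univ, true_and, Finset.mem_insert,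
      Finset.mem_singleton]
    constructor
    · intro h
      have := eq_of_vertex_eq h
      rw [next_next_of_not_isCrossing hd] at this
      tauto
    · rintro (rfl | rfl) <;> simp
  rw [this, Finset.sum_pair (P.next_ne d).symm]

end Projection

/-! ### The overlaid graph and its potentials -/

namespace MarkedDiagram

open Projection

variable {D : Type u} {Region : Type v} {P : MarkedDiagram D Region}

theorem finite_region [Finite D] (P : MarkedDiagram D Region) : Finite Region :=
  Finite.of_surjective _ P.region_surjective

theorem card_component (hP : P.Connected) : Nat.card P.Component = 1 := by
  obtain ⟨⟨d⟩, h⟩ := hP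
  exact Nat.card_eq_one_iff_unique.2 ⟨h, ⟨Quotient.mk _ d⟩⟩

theorem card_cells [Finite D] (hP : P.Connected) :
    Nat.card (P.Vertex ⊕ Region) + Nat.card P.Edge = Nat.card D + 2 := by
  have := P.finite_region
  have h₁ := P.euler
  have h₂ := P.tree
  have h₃ := P.card_dart
  rw [card_component hP] at h₁ h₂
  rw [Nat.card_sum]
  omega

/-- In a connected diagram the regions are the faces. -/
theorem map_eq_of_region_eq [Finite D] (hP : P.Connected) {β : Type*} {φ : D → β}
    (h : ∀ d, φ (P.faceNext d) = φ d) {a b : D} (hab : P.region a = P.region b) : φ a = φ b := by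
  have := P.finite_region
  let ρ : P.Face → Region := Quotient.lift P.region
    fun a b h => map_eq_of_sameCycle P.region_faceNext h
  have hρ : Function.Surjective ρ := fun r => by
    obtain ⟨d, rfl⟩ := P.region_surjective r
    exact ⟨Quotient.mk _ d, rfl⟩
  -- With a single component the tree condition leaves as many regions as faces, so the surjection
  -- `ρ` is a bijection.
  have hc : Nat.card P.Face ≤ Nat.card Region := by
    have h₂ := P.tree
    rw [card_component hP] at h₂
    omega
  have hbij := hρ.bijective_of_nat_card_le hc
  exact map_eq_of_sameCycle h (Quotient.exact (hbij.1 (a₁ := Quotient.mk _ a)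
    (a₂ := Quotient.mk _ b) hab))

/-- Summation by parts along region boundaries: the quadrant at `faceNext q` ends on the edge of
`q`, so reindexing by `faceNext` matches the two sums. -/
theorem sum_region_mul [Fintype D] {R : Type*} [CommRing R] (w : Region → R) (h : P.Edge → R) :
    ∑ q, w (P.region q) * (h (P.edge (P.next q)) - h (P.edge q)) = 0 := by
  simp only [mul_sub, Finset.sum_sub_distrib]
  rw [sub_eq_zero, ← Equiv.sum_comp P.faceNext]
  simp [P.region_faceNext]

theorem sum_vertex_mul [Fintype D] {R : Type*} [CommRing R] (w : P.Vertex → R) (h : P.Edge → R) :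
    ∑ q, w (P.vertex q) * (h (P.edge (P.next q)) - h (P.edge q)) = 0 := by
  simp only [mul_sub, Finset.sum_sub_distrib]
  rw [sub_eq_zero, ← Equiv.sum_comp P.next fun q => w (P.vertex q) * h (P.edge q)]
  simp

/-- The vertex end of the quadrant between `d` and `next d`, as an edge of the overlaid graph. -/
def vend (P : MarkedDiagram D Region) (d : D) : P.Vertex ⊕ Region := Sum.inl (P.vertex d)

/-- The region end of the quadrant between `d` and `next d`. -/
def rend (P : MarkedDiagram D Region) (d : D) : P.Vertex ⊕ Region := Sum.inr (P.region d)

/-- The edge that follows the quadrant between `d` and `next d`. -/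
def nextEdge (P : MarkedDiagram D Region) (d : D) : P.Edge := P.edge (P.next d)

theorem sum_orthogonal [Fintype D] (w : P.Vertex ⊕ Region → ℚ) (h : P.Edge → ℚ) :
    ∑ q, (w (P.vend q) - w (P.rend q)) * (h (P.nextEdge q) - h (P.edge q)) = 0 := by
  simp only [sub_mul, Finset.sum_sub_distrib]
  rw [show ∑ q, w (P.vend q) * (h (P.nextEdge q) - h (P.edge q)) = 0 from
    sum_vertex_mul (fun v => w (Sum.inl v)) h,
    show ∑ q, w (P.rend q) * (h (P.nextEdge q) - h (P.edge q)) = 0 from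
    sum_region_mul (fun v => w (Sum.inr v)) h, sub_zero]

theorem overlay_const (hP : P.Connected) (w : P.Vertex ⊕ Region → ℚ)
    (hw : ∀ q, w (P.vend q) = w (P.rend q)) (i j : P.Vertex ⊕ Region) : w i = w j := by
  have key := hP.map_eq (φ := fun d => w (P.vend d)) (fun d => by simp [vend]) (fun d => by
    have h₁ := hw (P.faceNext d)
    rw [rend, P.region_faceNext, vend, vertex_faceNext] at h₁
    exact h₁.trans (hw d).symm)
  have aux : ∀ i, ∃ d, w i = w (P.vend d) := by
    rintro (v | r)
    · obtain ⟨d, rfl⟩ := P.vertex_surjective v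
      exact ⟨d, rfl⟩
    · obtain ⟨d, rfl⟩ := P.region_surjective r
      exact ⟨d, (hw d).symm⟩
  obtain ⟨d, hd⟩ := aux i
  obtain ⟨e, he⟩ := aux j
  rw [hd, he]
  exact key d e

theorem edge_const (hP : P.Connected) {β : Type*} (h : P.Edge → β)
    (hh : ∀ q, h (P.nextEdge q) = h (P.edge q)) (i j : P.Edge) : h i = h j := by
  obtain ⟨d, rfl⟩ := P.edge_surjective i
  obtain ⟨e, rfl⟩ := P.edge_surjective j
  exact hP.map_eq (φ := fun d => h (P.edge d)) hh (fun d => by simp) d e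

theorem exists_edge_potential [Fintype D] (hP : P.Connected) (f : D → ℚ)
    (hf : ∀ w : P.Vertex ⊕ Region → ℚ, ∑ q, (w (P.vend q) - w (P.rend q)) * f q = 0) :
    ∃ h : P.Edge → ℚ, ∀ q, h (P.nextEdge q) - h (P.edge q) = f q := by
  have := P.finite_region
  exact exists_potential _ _ _ _ sum_orthogonal (overlay_const hP) (edge_const hP)
    (card_cells hP) f hf

theorem exists_overlay_potential [Fintype D] (hP : P.Connected) (f : D → ℚ)
    (hf : ∀ h : P.Edge → ℚ, ∑ q, (h (P.nextEdge q) - h (P.edge q)) * f q = 0) :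
    ∃ w : P.Vertex ⊕ Region → ℚ, ∀ q, w (P.vend q) - w (P.rend q) = f q := by
  have := P.finite_region
  exact exists_potential _ _ _ _ (fun h w => by simpa only [mul_comm] using sum_orthogonal w h)
    (edge_const hP) (overlay_const hP) (by rw [add_comm]; exact card_cells hP) f hf

/-! ### Chosen quadrants and height functions -/

/-- The quadrant between `d` and `next d` is chosen in the state `x`. -/
def Used (x : P.KauffmanState) (d : D) : Prop := ∃ c, x.quadrant c = d

theorem Used.isCrossing {x : P.KauffmanState} {d : D} (h : Used x d) :
    P.IsCrossing (P.vertex d) := by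
  obtain ⟨c, rfl⟩ := h
  rw [x.vertex_quadrant]
  exact c.2

theorem Used.quadrant_eq {x : P.KauffmanState} {d : D} (h : Used x d) :
    x.quadrant ⟨P.vertex d, h.isCrossing⟩ = d := by
  obtain ⟨c, rfl⟩ := h
  congr 1
  exact Subtype.ext (x.vertex_quadrant c)

theorem used_quadrant (x : P.KauffmanState) (c : P.Crossing) : Used x (x.quadrant c) := ⟨c, rfl⟩

theorem Used.eq_of_vertex {x : P.KauffmanState} {d d' : D} (h : Used x d) (h' : Used x d')
    (hv : P.vertex d = P.vertex d') : d = d' := by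
  rw [← h.quadrant_eq, ← h'.quadrant_eq]
  congr 1
  exact Subtype.ext hv

theorem Used.not_distinguished {x : P.KauffmanState} {d : D} (h : Used x d) :
    ¬ P.Distinguished (P.region d) := by
  obtain ⟨c, rfl⟩ := h
  exact x.bijOn.mapsTo (Set.mem_univ c)

theorem Used.eq_of_region {x : P.KauffmanState} {d d' : D} (h : Used x d) (h' : Used x d')
    (hv : P.region d = P.region d') : d = d' := by
  obtain ⟨c, rfl⟩ := h
  obtain ⟨c', rfl⟩ := h'
  rw [x.bijOn.injOn (Set.mem_univ c) (Set.mem_univ c') hv]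

theorem exists_used_region (x : P.KauffmanState) {r : Region} (hr : ¬ P.Distinguished r) :
    ∃ d, Used x d ∧ P.region d = r := by
  obtain ⟨c, -, hc⟩ := x.bijOn.surjOn hr
  exact ⟨_, ⟨c, rfl⟩, hc⟩

theorem exists_used_vertex (x : P.KauffmanState) {v : P.Vertex} (hv : P.IsCrossing v) :
    ∃ d, Used x d ∧ P.vertex d = v :=
  ⟨_, ⟨⟨v, hv⟩, rfl⟩, x.vertex_quadrant _⟩

theorem quadrant_injective (x : P.KauffmanState) : Function.Injective x.quadrant := by
  intro c c' h
  apply Subtype.ext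
  rw [← x.vertex_quadrant, h, x.vertex_quadrant]

theorem KauffmanState.ext' {x y : P.KauffmanState} (h : ∀ c, x.quadrant c = y.quadrant c) :
    x = y := by
  cases x
  cases y
  congr
  exact funext h

open Classical in
/-- The indicator function of the quadrants chosen in `x`. -/
noncomputable def chosen (x : P.KauffmanState) (d : D) : ℚ := if Used x d then 1 else 0

theorem ext_of_chosen {x y : P.KauffmanState} (h : ∀ d, chosen x d = chosen y d) : x = y := by
  apply KauffmanState.ext'
  intro c
  have hc := h (x.quadrant c)
  rw [chosen, if_pos (used_quadrant x c), chosen] at hc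
  split_ifs at hc with hu
  · exact (used_quadrant y c).eq_of_vertex hu (by rw [x.vertex_quadrant, y.vertex_quadrant]) |>.symm
  · norm_num at hc

theorem finite_state [Finite D] : Finite P.KauffmanState :=
  Finite.of_injective (fun x => x.quadrant) fun _ _ h => KauffmanState.ext' fun c => congrFun h c

theorem sum_mul_chosen [Fintype D] [Fintype P.Crossing] (x : P.KauffmanState) (F : D → ℚ) :
    ∑ d, F d * chosen x d = ∑ c, F (x.quadrant c) := by
  classical
  rw [← Finset.sum_image (s := Finset.univ) (g := x.quadrant) (f := F)
    fun c _ c' _ h => quadrant_injective x h]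
  simp only [chosen, mul_ite, mul_one, mul_zero]
  rw [← Finset.sum_filter]
  congr 1
  ext d
  simp [Used]

theorem sum_vertex_chosen [Fintype D] (x y : P.KauffmanState) (w : P.Vertex → ℚ) :
    ∑ d, w (P.vertex d) * chosen x d = ∑ d, w (P.vertex d) * chosen y d := by
  have := Fintype.ofFinite P.Crossing
  simp [sum_mul_chosen, KauffmanState.vertex_quadrant]

theorem sum_region_chosen [Fintype D] (x y : P.KauffmanState) (w : Region → ℚ) :
    ∑ d, w (P.region d) * chosen x d = ∑ d, w (P.region d) * chosen y d := by
  have := Fintype.ofFinite P.Crossing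
  simp only [sum_mul_chosen]
  have key : ∀ z : P.KauffmanState, ∑ c, w (P.region (z.quadrant c)) =
      ∑ᶠ r ∈ {r | ¬ P.Distinguished r}, w r := by
    intro z
    rw [← finsum_eq_sum_of_fintype, ← finsum_mem_univ]
    exact finsum_mem_eq_of_bijOn _ z.bijOn fun _ _ => rfl
  rw [key, key]

/-- The difference of two states is the coboundary of a height function on the edges. -/
theorem exists_height [Fintype D] (hP : P.Connected) (x y : P.KauffmanState) :
    ∃ h : P.Edge → ℚ, ∀ q, h (P.nextEdge q) - h (P.edge q) = chosen x q - chosen y q := by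
  apply exists_edge_potential hP
  intro w
  have h₁ := sum_vertex_chosen x y fun v => w (Sum.inl v)
  have h₂ := sum_region_chosen x y fun r => w (Sum.inr r)
  simp only [mul_sub, sub_mul, Finset.sum_sub_distrib, vend, rend]
  linarith

theorem ncard_edge_preimage [Finite D] (A : Set P.Edge) :
    (P.edge ⁻¹' A).ncard = 2 * A.ncard := by
  classical
  have := Fintype.ofFinite D
  have := Fintype.ofFinite P.Edge
  have h := P.sum_edge fun e => if e ∈ A then 1 else 0
  simp only [← two_mul, ← Finset.mul_sum] at h
  rw [Set.ncard_eq_toFinset_card', Set.ncard_eq_toFinset_card']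
  simpa using h

theorem Used.chosen_eq {x : P.KauffmanState} {d : D} (h : Used x d) : chosen x d = 1 := if_pos h

theorem chosen_eq_zero {x : P.KauffmanState} {d : D} (h : ¬ Used x d) : chosen x d = 0 := if_neg h

theorem Used.not_next {x : P.KauffmanState} {d : D} (h : Used x d) : ¬ Used x (P.next d) :=
  fun h' => P.next_ne d (h'.eq_of_vertex h (by simp))

theorem Used.not_next_next {x : P.KauffmanState} {d : D} (h : Used x d) :
    ¬ Used x (P.next (P.next d)) :=
  fun h' => h.isCrossing d rfl (h'.eq_of_vertex h (by simp))

theorem Used.not_next_next_next {x : P.KauffmanState} {d : D} (h : Used x d) :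
    ¬ Used x (P.next (P.next (P.next d))) :=
  fun h' => h'.not_next (by rwa [P.next_four])

/-- Used for counting vertices by weighted darts: the four darts at a crossing are listed from its
chosen quadrant, so only the local pattern there needs checking. -/
theorem sum_vertex_two [Fintype D] (x : P.KauffmanState) (F : D → ℤ) (T : Set P.Vertex)
    (h₁ : ∀ d, P.vertex d ∈ T → Used x d →
      F d + (F (P.next d) + (F (P.next (P.next d)) + F (P.next (P.next (P.next d))))) = 2)
    (h₂ : ∀ d, P.vertex d ∈ T → ¬ P.IsCrossing (P.vertex d) → F d + F (P.next d) = 2)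
    [DecidablePred fun d => P.vertex d ∈ T] :
    ∑ d with P.vertex d ∈ T, F d = 2 * T.ncard := by
  classical
  have := Fintype.ofFinite P.Vertex
  rw [← Finset.sum_fiberwise_of_maps_to (t := T.toFinset) (g := P.vertex) (by simp),
    Set.ncard_eq_toFinset_card', mul_comm, ← nsmul_eq_mul, ← Finset.sum_const]
  refine Finset.sum_congr rfl fun v hv => ?_
  obtain ⟨d, rfl⟩ := P.vertex_surjective v
  have hd : P.vertex d ∈ T := by simpa using hv
  have e : ((Finset.univ.filter fun d => P.vertex d ∈ T).filter fun d' => P.vertex d' = P.vertex d)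
      = Finset.univ.filter fun d' => P.vertex d' = P.vertex d := by
    rw [Finset.filter_filter]
    ext d'
    simp only [Finset.mem_filter, Finset.mem_univ, true_and, and_iff_right_iff_imp]
    intro h
    rwa [h]
  rw [e]
  by_cases hc : P.IsCrossing (P.vertex d)
  · obtain ⟨d', hu, hd'⟩ := exists_used_vertex x hc
    rw [← hd', sum_vertex_of_isCrossing F (hd' ▸ hc)]
    exact h₁ d' (hd' ▸ hd) hu
  · rw [sum_vertex_of_not_isCrossing F hc]
    exact h₂ d hd hc

/-! ### Accessibility from the distinguished regions -/

/-- The cells of the overlaid graph that are accessible from the distinguished regions by paths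
that leave every crossing through its chosen quadrant. -/
inductive Accessible (x : P.KauffmanState) : P.Vertex ⊕ Region → Prop
  | distinguished {r : Region} : P.Distinguished r → Accessible x (Sum.inr r)
  | vend {d : D} : Accessible x (P.rend d) → Accessible x (P.vend d)
  | rend {d : D} : Used x d → Accessible x (P.vend d) → Accessible x (P.rend d)

theorem distinguished_mark : P.Distinguished (P.region P.mark) := Or.inl rfl

/-- A function on the edges that does not change across quadrants at accessible cells is constant
on the edges incident with these cells. -/
theorem edge_const_of_accessible [Finite D] (hP : P.Connected) (x : P.KauffmanState)
    (h : P.Edge → ℚ) (hh : ∀ q ∈ touching P.vend P.rend {i | Accessible x i},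
      h (P.nextEdge q) = h (P.edge q)) {i : P.Vertex ⊕ Region} (hi : Accessible x i) :
    ∀ q, (P.vend q = i ∨ P.rend q = i) → h (P.edge q) = h (P.edge P.mark) := by
  have reg : ∀ d e, Accessible x (P.rend d) → P.region e = P.region d →
      h (P.edge e) = h (P.edge d) := by
    intro d e hd he
    have key := map_eq_of_region_eq hP
      (φ := fun d' => (P.region d' = P.region d → h (P.edge d') = h (P.edge d))) ?_ he
    · exact key.mpr (fun _ => rfl) he
    · intro d'
      apply propext
      rw [P.region_faceNext]
      refine imp_congr_right fun h' => ?_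
      have := hh (P.faceNext d') (Or.inr (by
        change Accessible x (P.rend _)
        rwa [rend, P.region_faceNext, h']))
      rw [nextEdge, next_faceNext, edge_flip] at this
      rw [this]
  have ver : ∀ d e, Accessible x (P.vend d) → P.vertex e = P.vertex d →
      h (P.edge e) = h (P.edge d) := by
    intro d e hd he
    have key := map_eq_of_vertex_eq
      (φ := fun d' => (P.vertex d' = P.vertex d → h (P.edge d') = h (P.edge d))) ?_ he
    · exact key.mpr (fun _ => rfl) he
    · intro d'
      apply propext
      rw [vertex_next]
      refine imp_congr_right fun h' => ?_
      have := hh d' (Or.inl (by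
        change Accessible x (P.vend _)
        rwa [vend, h']))
      rw [← this]
      rfl
  induction hi with
  | @distinguished r hr =>
    rintro q (hq | hq)
    · simp [vend] at hq
    · simp only [rend, Sum.inr.injEq] at hq
      subst hq
      have acc : ∀ d, P.Distinguished (P.region d) → Accessible x (P.rend d) :=
        fun d hd => .distinguished hd
      rcases hr with hr | hr
      · exact reg _ _ (acc _ (Or.inl rfl)) hr
      · rw [reg _ _ (acc _ (Or.inr rfl)) hr, edge_flip]
  | @vend d hd ih =>
    rintro q (hq | hq)
    · simp only [MarkedDiagram.vend, Sum.inl.injEq] at hq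
      rw [ver d q (.vend hd) hq]
      exact ih d (Or.inr rfl)
    · simp [MarkedDiagram.vend, MarkedDiagram.rend] at hq
  | @rend d hu hd ih =>
    rintro q (hq | hq)
    · simp [MarkedDiagram.vend, MarkedDiagram.rend] at hq
    · simp only [MarkedDiagram.rend, Sum.inr.injEq] at hq
      rw [reg d q (.rend hu hd) hq]
      exact ih d (Or.inl rfl)

/-- If some cell were inaccessible, the local Euler inequality for the accessible ones, subtracted
from Euler's formula, would give `|B| + 1 ≤ |TV| + |TR| + |Jᶜ|`. But `|Jᶜ| ≤ |B| / 2`, and an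
inaccessible region has its chosen quadrant at an inaccessible vertex, whence `|TV| + |TR| ≤ |B| /
2`. -/
theorem accessible [Fintype D] (hP : P.Connected) (x : P.KauffmanState) (i : P.Vertex ⊕ Region) :
    Accessible x i := by
  classical
  by_contra hi
  have := P.finite_region
  have := Fintype.ofFinite Region
  have := Fintype.ofFinite P.Vertex
  let S : Set (P.Vertex ⊕ Region) := {i | Accessible x i}
  let J := dualTouching P.vend P.rend P.nextEdge P.edge S
  have L := ncard_add_ncard_le P.vend P.rend P.nextEdge P.edge sum_orthogonal S ?_ ?_
  rotate_left
  · intro w hw h j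
    rw [overlay_const hP w h j i]
    exact hw i hi
  · intro h hh
    have aux : ∀ j ∈ J, h j = h (P.edge P.mark) := by
      rintro j ⟨q, hq, hj⟩
      have h₁ : h j = h (P.edge q) := by
        rcases hj with rfl | rfl
        · exact hh q hq
        · rfl
      rw [h₁]
      rcases hq with hq | hq
      · exact edge_const_of_accessible hP x h hh hq q (Or.inl rfl)
      · exact edge_const_of_accessible hP x h hh hq q (Or.inr rfl)
    intro j hj j' hj'
    rw [aux j hj, aux j' hj']
  let TV : Set P.Vertex := {v | ¬ Accessible x (Sum.inl v)}
  let TR : Set Region := {r | ¬ Accessible x (Sum.inr r)}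
  let B : Set D := {d | P.vertex d ∈ TV}
  let U : Set D := {d | P.vertex d ∈ TV ∧ Used x d}
  have hS : S.ncard + (TV.ncard + TR.ncard) = Nat.card (P.Vertex ⊕ Region) := by
    rw [← Set.ncard_add_ncard_compl S, add_right_inj,
      ← Set.ncard_image_of_injective TV (Sum.inl_injective (β := Region)),
      ← Set.ncard_image_of_injective TR (Sum.inr_injective (α := P.Vertex)),
      ← Set.ncard_union_eq]
    · congr 1
      ext (v | r) <;> simp [S, TV, TR]
    · rw [Set.disjoint_left]
      rintro _ ⟨v, -, rfl⟩ ⟨r, -, h⟩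
      cases h
  have hB : B = (touching P.vend P.rend S)ᶜ := by
    ext d
    simp only [B, TV, touching, Set.mem_compl_iff, Set.mem_ofPred_eq, not_or, S]
    exact ⟨fun h => ⟨h, fun h' => h (.vend h')⟩, fun h => h.1⟩
  have hB' := Set.ncard_add_ncard_compl (touching P.vend P.rend S)
  rw [← hB] at hB'
  have hJ := Set.ncard_add_ncard_compl J
  have hJB : 2 * Jᶜ.ncard ≤ B.ncard := by
    rw [← ncard_edge_preimage, hB]
    refine Set.ncard_le_ncard ?_
    intro d hd hd'
    exact hd ⟨d, hd', Or.inr rfl⟩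
  have hRU : TR.ncard ≤ U.ncard := by
    have : TR ⊆ P.region '' U := by
      intro r hr
      obtain ⟨d, hd, rfl⟩ := exists_used_region x (r := r) fun h => hr (.distinguished h)
      exact ⟨d, ⟨fun h => hr (.rend hd h), hd⟩, rfl⟩
    exact (Set.ncard_le_ncard this).trans (Set.ncard_image_le)
  -- The weights add up to 4 - 2 at a crossing and to 1 + 1 at a two-valent vertex.
  have hsum := sum_vertex_two x (fun d => 1 - 2 * if Used x d then 1 else 0) TV ?_ ?_
  rotate_left
  · intro d _ h
    rw [if_pos h, if_neg h.not_next, if_neg h.not_next_next, if_neg h.not_next_next_next]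
    norm_num
  · intro d _ hc
    rw [if_neg fun h => hc h.isCrossing, if_neg fun h => hc (by simpa using h.isCrossing)]
    norm_num
  have hBU : (B.ncard : ℤ) - 2 * U.ncard = 2 * TV.ncard := by
    rw [← hsum, Finset.sum_sub_distrib, ← Finset.mul_sum, Finset.sum_boole,
      Set.ncard_eq_toFinset_card', Set.ncard_eq_toFinset_card', Finset.filter_filter]
    simp [B, U]
  have hcells := P.card_cells hP
  have hd := P.card_dart
  change S.ncard + J.ncard ≤ _ at L
  omega

/-! ### Lowerable sets and their outside -/

/-- `V` is a nonempty set of edges on which the height function of the state `x` can be lowered,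
away from the distinguished regions. -/
structure IsLowerable (x : P.KauffmanState) (V : Set P.Edge) : Prop where
  nonempty : V.Nonempty
  inner : ∀ d, P.edge d ∈ V → ¬ P.Distinguished (P.region d)
  closed : ∀ d, P.nextEdge d ∈ V → P.edge d ∈ V ∨ Used x d

/-- The component of the complement of `V` that contains the marked edge. -/
inductive Outside (V : Set P.Edge) : P.Edge → Prop
  | mark : Outside V (P.edge P.mark)
  | vertex {d e : D} : Outside V (P.edge d) → P.vertex d = P.vertex e → P.edge e ∉ V →
      Outside V (P.edge e)
  | region {d e : D} : Outside V (P.edge d) → P.region d = P.region e → P.edge e ∉ V →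
      Outside V (P.edge e)

variable {x : P.KauffmanState} {V : Set P.Edge}

theorem IsLowerable.not_mem_of_outside (hV : IsLowerable x V) {e : P.Edge} (he : Outside V e) :
    e ∉ V := by
  cases he with
  | mark => exact fun h => hV.inner _ h distinguished_mark
  | vertex _ _ h => exact h
  | region _ _ h => exact h

theorem IsLowerable.outside_of_distinguished (hV : IsLowerable x V) {d : D}
    (hd : P.Distinguished (P.region d)) : Outside V (P.edge d) := by
  have hd' : P.edge d ∉ V := fun h => hV.inner d h hd
  rcases hd with hd | hd
  · exact .region .mark hd.symm hd'
  · exact .region (d := P.flip P.mark) (by rw [edge_flip]; exact .mark) hd.symm hd'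

/-- Filling the holes of `V` is harmless: a rotation from the outside to the filled set must end in
`V` itself, so it crosses a chosen quadrant. -/
theorem IsLowerable.compl_outside (hV : IsLowerable x V) :
    IsLowerable x {e | ¬ Outside V e} where
  nonempty := by
    obtain ⟨e, he⟩ := hV.nonempty
    exact ⟨e, fun h => hV.not_mem_of_outside h he⟩
  inner d hd h := hd (hV.outside_of_distinguished h)
  closed d hd := by
    by_contra! h
    obtain ⟨h, hu⟩ := h
    have h : Outside V (P.edge d) := not_not.1 h
    have hn : P.nextEdge d ∈ V := by
      by_contra hn
      exact hd (.vertex h (vertex_next d).symm hn)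
    rcases hV.closed d hn with h' | h'
    · exact hV.not_mem_of_outside h h'
    · exact hu h'

/-- The four cells around an edge. -/
theorem overlay_eq_of_edge {w : P.Vertex ⊕ Region → ℚ} {d : D}
    (hw : ∀ q, P.edge q = P.edge d ∨ P.nextEdge q = P.edge d → w (P.vend q) = w (P.rend q))
    {d' : D} (hd' : P.edge d' = P.edge d) :
    w (P.vend d') = w (P.vend d) ∧ w (P.rend d') = w (P.vend d) := by
  have h₁ := hw d' (Or.inl hd')
  have h₂ := hw d (Or.inl rfl)
  have h₃ := hw (P.faceNext d) (Or.inr (by rw [nextEdge, next_faceNext, edge_flip]))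
  rw [vend, rend, vertex_faceNext, P.region_faceNext] at h₃
  change w (P.vend (P.flip d)) = w (P.rend d) at h₃
  rcases eq_of_edge_eq hd' with rfl | rfl
  · exact ⟨rfl, h₁.symm⟩
  · exact ⟨h₃.trans h₂.symm, h₁.symm.trans (h₃.trans h₂.symm)⟩

theorem overlay_const_outside {w : P.Vertex ⊕ Region → ℚ}
    (hw : ∀ q, Outside V (P.edge q) ∨ Outside V (P.nextEdge q) → w (P.vend q) = w (P.rend q))
    {d : D} (hd : Outside V (P.edge d)) :
    w (P.vend d) = w (P.rend P.mark) ∧ w (P.rend d) = w (P.rend P.mark) := by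
  have quad : ∀ {d d'}, Outside V (P.edge d) → P.edge d' = P.edge d →
      w (P.vend d') = w (P.vend d) ∧ w (P.rend d') = w (P.vend d) := by
    intro d d' h hd'
    refine overlay_eq_of_edge (fun q hq => hw q ?_) hd'
    rcases hq with hq | hq
    · exact Or.inl (hq ▸ h)
    · exact Or.inr (hq ▸ h)
  suffices H : ∀ i, Outside V i → ∀ d, P.edge d = i →
      w (P.vend d) = w (P.rend P.mark) ∧ w (P.rend d) = w (P.rend P.mark) from H _ hd d rfl
  intro i hi
  induction hi with
  | mark =>
    intro d hd
    have h₀ := hw P.mark (Or.inl .mark)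
    have := quad .mark hd
    rwa [h₀] at this
  | @vertex d e hd hde he ih =>
    intro d' hd'
    have := quad (.vertex hd hde he) hd'
    rw [show P.vend e = P.vend d from congrArg Sum.inl hde.symm, (ih d rfl).1] at this
    exact this
  | @region d e hd hde he ih =>
    intro d' hd'
    have h' : Outside V (P.edge e) := .region hd hde he
    have := quad h' hd'
    rw [hw e (Or.inl h'), show P.rend e = P.rend d from congrArg Sum.inr hde.symm,
      (ih d rfl).2] at this
    exact this

/-- A lowerable set without smaller lowerable subsets. -/
structure IsMinimalLowerable (x : P.KauffmanState) (V : Set P.Edge) : Prop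
    extends IsLowerable x V where
  minimal : ∀ A ⊆ V, IsLowerable x A → A = V

/-- The edges of `V` satisfying `p` form a lowerable subset, which minimality forces to be all of
`V`. Thus any edge of `V` is reached from any other by clockwise rotations across unchosen quadrants
inside `V`. -/
theorem IsMinimalLowerable.induction (hV : IsMinimalLowerable x V) {p : P.Edge → Prop}
    {e₀ : P.Edge} (h₀ : e₀ ∈ V) (hp : p e₀)
    (ih : ∀ d, P.edge d ∈ V → P.nextEdge d ∈ V → ¬ Used x d → p (P.nextEdge d) → p (P.edge d))
    {e : P.Edge} (he : e ∈ V) : p e := by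
  have : {e | e ∈ V ∧ p e} = V := by
    refine hV.minimal _ (fun _ h => h.1) ⟨⟨e₀, h₀, hp⟩, fun d hd => hV.inner d hd.1, ?_⟩
    rintro d ⟨hd, hpd⟩
    by_cases hu : Used x d
    · exact Or.inr hu
    · have := (hV.closed d hd).resolve_right hu
      exact Or.inl ⟨this, ih d this hd hu hpd⟩
  rw [← this] at he
  exact he.2

theorem exists_isMinimalLowerable [Finite D] (hV : IsLowerable x V) :
    ∃ A, IsMinimalLowerable x A := by
  obtain ⟨A, hA, hmin⟩ := Set.exists_min_image {A | IsLowerable x A} Set.ncard (Set.toFinite _)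
    ⟨V, hV⟩
  exact ⟨A, hA, fun B hB h => Set.eq_of_subset_of_ncard_le hB (hmin B h)⟩

theorem IsMinimalLowerable.overlay_const (hV : IsMinimalLowerable x V)
    {w : P.Vertex ⊕ Region → ℚ}
    (hw : ∀ q, P.edge q ∈ V ∨ P.nextEdge q ∈ V → w (P.vend q) = w (P.rend q))
    {d d' : D} (hd : P.edge d ∈ V) (hd' : P.edge d' ∈ V) :
    w (P.vend d') = w (P.vend d) ∧ w (P.rend d') = w (P.vend d) := by
  have quad : ∀ {d d'}, P.edge d ∈ V → P.edge d' = P.edge d →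
      w (P.vend d') = w (P.vend d) ∧ w (P.rend d') = w (P.vend d) := by
    intro d d' h hd'
    refine overlay_eq_of_edge (fun q hq => hw q ?_) hd'
    rcases hq with hq | hq
    · exact Or.inl (hq ▸ h)
    · exact Or.inr (hq ▸ h)
  refine hV.induction (p := fun i => ∀ d', P.edge d' = i →
    w (P.vend d') = w (P.vend d) ∧ w (P.rend d') = w (P.vend d)) hd
    (fun d' h => quad hd h) ?_ hd' d' rfl
  intro e he he' _ ih d' hd'
  have := quad he hd'
  have h' := (ih (P.next e) rfl).1
  rw [vend, vertex_next] at h'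
  rw [show w (P.vend e) = _ from h'] at this
  exact this

/-- The overlaid graph, restricted to the cells incident with the complement of the outside, is
connected. -/
theorem IsMinimalLowerable.overlay_const_compl (hP : P.Connected) (hV : IsMinimalLowerable x V)
    {w : P.Vertex ⊕ Region → ℚ}
    (hw : ∀ q, ¬ Outside V (P.edge q) ∨ ¬ Outside V (P.nextEdge q) → w (P.vend q) = w (P.rend q)) :
    ∃ κ, ∀ d, ¬ Outside V (P.edge d) → w (P.vend d) = κ ∧ w (P.rend d) = κ := by
  have sub : ∀ {e}, e ∈ V → ¬ Outside V e := fun he h => hV.not_mem_of_outside h he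
  obtain ⟨e₀, he₀⟩ := hV.nonempty
  obtain ⟨d₀, rfl⟩ := P.edge_surjective e₀
  have hVκ := fun d' => hV.overlay_const (w := w) (fun q hq => hw q (hq.imp sub sub)) he₀ (d' := d')
  refine ⟨w (P.vend d₀), fun d hd => ?_⟩
  suffices H : w (P.vend d) = w (P.vend d₀) from ⟨H, (hw d (Or.inl hd)).symm.trans H⟩
  by_contra hne
  -- A vertex carrying an edge of this kind meets no edge of `V`, so one outside edge there would
  -- make all its edges outside. The predicate is therefore invariant, yet it fails at the mark.
  have key := hP.map_eq
    (φ := fun d => ¬ Outside V (P.edge d) ∧ w (P.vend d) ≠ w (P.vend d₀)) ?_ ?_ d P.mark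
  · exact (key.mp ⟨hd, hne⟩).1 .mark
  · have step : ∀ a b, P.vertex a = P.vertex b →
        (¬ Outside V (P.edge a) ∧ w (P.vend a) ≠ w (P.vend d₀)) →
        (¬ Outside V (P.edge b) ∧ w (P.vend b) ≠ w (P.vend d₀)) := by
      rintro a b hab ⟨ha, ha'⟩
      refine ⟨fun hb => ha (.vertex hb hab.symm fun h => ha' (hVκ a h).1), ?_⟩
      rw [vend, hab] at ha'
      exact ha'
    intro d
    exact propext ⟨step _ _ (vertex_next d), step _ _ (vertex_next d).symm⟩
  · have step : ∀ a, (¬ Outside V (P.edge a) ∧ w (P.vend a) ≠ w (P.vend d₀)) →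
        (¬ Outside V (P.edge (P.flip a)) ∧ w (P.vend (P.flip a)) ≠ w (P.vend d₀)) := by
      rintro a ⟨ha, ha'⟩
      rw [edge_flip]
      refine ⟨ha, ?_⟩
      rwa [(overlay_eq_of_edge (d := a) (fun q hq => hw q ?_) (edge_flip a)).1]
      rcases hq with hq | hq
      · exact Or.inl (hq ▸ ha)
      · exact Or.inr (hq ▸ ha)
    intro d
    refine propext ⟨fun h => ?_, step d⟩
    simpa only [P.flip_flip] using step _ h

/-- At a vertex incident with the outside, all quadrants between edges of `V` are chosen. -/
theorem IsMinimalLowerable.used_of_outside [Fintype D] (hP : P.Connected)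
    (hV : IsMinimalLowerable x V) {d d₀ : D} (hd : P.edge d ∈ V) (hd' : P.nextEdge d ∈ V)
    (h₀ : Outside V (P.edge d₀)) (hv : P.vertex d₀ = P.vertex d) : Used x d := by
  classical
  by_contra hu
  -- A path of rotations from `nextEdge d` back to `edge d` across unchosen quadrants in `V`; the
  -- rotation across `d` closes it to a circulation, with overlay potential `w`.
  have flow : ∃ f : D → ℚ, (∀ q, 0 ≤ f q) ∧
      (∀ q, f q ≠ 0 → ¬ Used x q ∧ P.edge q ∈ V ∧ P.nextEdge q ∈ V) ∧
      ∀ h : P.Edge → ℚ, ∑ q, (h (P.nextEdge q) - h (P.edge q)) * f q =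
        h (P.edge d) - h (P.nextEdge d) := by
    refine hV.induction (p := fun e => ∃ f : D → ℚ, (∀ q, 0 ≤ f q) ∧
      (∀ q, f q ≠ 0 → ¬ Used x q ∧ P.edge q ∈ V ∧ P.nextEdge q ∈ V) ∧
      ∀ h : P.Edge → ℚ, ∑ q, (h (P.nextEdge q) - h (P.edge q)) * f q =
        h (P.edge d) - h e) hd ⟨0, by simp, by simp, by simp⟩ ?_ hd'
    rintro a ha ha' hua ⟨f, h₁, h₂, h₃⟩
    refine ⟨f + Pi.single a 1, fun q => ?_, fun q hq => ?_, fun h => ?_⟩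
    · have : (0 : ℚ) ≤ (Pi.single a 1 : D → ℚ) q := by
        rw [Pi.single_apply]
        split_ifs <;> norm_num
      exact add_nonneg (h₁ q) this
    · by_cases hqa : q = a
      · subst hqa
        exact ⟨hua, ha, ha'⟩
      · apply h₂
        simpa [hqa] using hq
    · simp only [Pi.add_apply, mul_add, Finset.sum_add_distrib, h₃, Pi.single_apply, mul_ite,
        mul_one, mul_zero, Finset.sum_ite_eq', Finset.mem_univ, if_true]
      ring
  obtain ⟨f, h₁, h₂, h₃⟩ := flow
  obtain ⟨w, hw⟩ := exists_overlay_potential hP (f + Pi.single d 1) fun h => by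
    simp only [Pi.add_apply, mul_add, Finset.sum_add_distrib, h₃, Pi.single_apply, mul_ite,
      mul_one, mul_zero, Finset.sum_ite_eq', Finset.mem_univ, if_true]
    ring
  have hout : ∀ q, Outside V (P.edge q) ∨ Outside V (P.nextEdge q) →
      w (P.vend q) = w (P.rend q) := by
    intro q hq
    have hq' : ¬ (P.edge q ∈ V ∧ P.nextEdge q ∈ V) := by
      rintro ⟨ha, hb⟩
      rcases hq with hq | hq
      · exact hV.not_mem_of_outside hq ha
      · exact hV.not_mem_of_outside hq hb
    have hfq : f q = 0 := by
      by_contra h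
      exact hq' (h₂ q h).2
    have hqd : q ≠ d := by
      rintro rfl
      exact hq' ⟨hd, hd'⟩
    have := hw q
    simp only [Pi.add_apply, hfq, Pi.single_apply, hqd, if_false, add_zero] at this
    linarith
  -- Along an accessible path `w` cannot decrease: passing from a region to a vertex adds a
  -- nonnegative flow, and chosen quadrants carry none.
  have hmark : ∀ i, Accessible x i → w (P.rend P.mark) ≤ w i := by
    intro i hi
    induction hi with
    | @distinguished r hr =>
      rcases hr with rfl | rfl
      · exact le_rfl
      · exact (overlay_const_outside hout (d := P.flip P.mark)
          (by rw [edge_flip]; exact .mark)).2.ge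
    | @vend q _ ih =>
      have := hw q
      have h' : (0 : ℚ) ≤ (f + Pi.single d 1 : D → ℚ) q := by
        rw [Pi.add_apply, Pi.single_apply]
        have := h₁ q
        split_ifs <;> linarith
      linarith
    | @rend q hq _ ih =>
      have := hw q
      have hfq : f q = 0 := by
        by_contra h
        exact (h₂ q h).1 hq
      have hqd : q ≠ d := by
        rintro rfl
        exact hu hq
      simp only [Pi.add_apply, hfq, Pi.single_apply, hqd, if_false, add_zero] at this
      linarith
  -- The vertex of `d` touches the outside, so `w` there equals its value at the mark; the region of
  -- `d` lies at least 1 lower, below the minimum.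
  have hd₁ := hw d
  have hd₂ := hmark _ (accessible hP x (P.rend d))
  have hd₃ := (overlay_const_outside hout h₀).1
  rw [show P.vend d₀ = P.vend d from congrArg Sum.inl hv] at hd₃
  simp only [Pi.add_apply, Pi.single_eq_same] at hd₁
  have := h₁ d
  linarith

/-! ### The boundary of the filled set -/

/-- Along the boundary of a region a set of edges is entered as often as it is left. -/
theorem mem_nextEdge_of_region [Fintype D] (W : Set P.Edge) (r : Region)
    (h : ∀ q, P.region q = r → P.nextEdge q ∈ W → P.edge q ∈ W) {q : D} (hq : P.region q = r)
    (hqW : P.edge q ∈ W) : P.nextEdge q ∈ W := by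
  classical
  by_contra hn
  have key := sum_region_mul (P := P) (fun r' => if r' = r then (1 : ℚ) else 0)
    (fun e => if e ∈ W then 1 else 0)
  have : ∑ q, (if P.region q = r then (1 : ℚ) else 0) * ((if P.edge (P.next q) ∈ W then 1 else 0) -
      if P.edge q ∈ W then 1 else 0) < ∑ q : D, 0 := by
    refine Finset.sum_lt_sum (fun d _ => ?_) ⟨q, Finset.mem_univ q, ?_⟩
    · by_cases hd : P.region d = r
      · by_cases hW : P.edge (P.next d) ∈ W
        · simp [hW, h d hd hW]
        · rw [if_pos hd, if_neg hW]
          split_ifs <;> norm_num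
      · simp [hd]
    · rw [if_pos hq, if_pos hqW, if_neg (show P.edge (P.next q) ∉ W from hn)]
      norm_num
  rw [key] at this
  simp at this

theorem mem_edge_of_region [Fintype D] (W : Set P.Edge) (r : Region)
    (h : ∀ q, P.region q = r → P.edge q ∈ W → P.nextEdge q ∈ W) {q : D} (hq : P.region q = r)
    (hqW : P.nextEdge q ∈ W) : P.edge q ∈ W := by
  by_contra hn
  exact mem_nextEdge_of_region Wᶜ r (fun q hq hn h' => hn (h q hq h')) hq hn hqW

/-- Counterclockwise rotation across the quadrant leaves the outside of `V`. -/
def IsEntry (V : Set P.Edge) (q : D) : Prop :=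
  Outside V (P.edge q) ∧ ¬ Outside V (P.nextEdge q)

/-- Counterclockwise rotation across the quadrant enters the outside of `V`. -/
def IsExit (V : Set P.Edge) (q : D) : Prop :=
  ¬ Outside V (P.edge q) ∧ Outside V (P.nextEdge q)

theorem IsLowerable.used_of_isEntry (hV : IsLowerable x V) {q : D} (hq : IsEntry V q) :
    Used x q :=
  (hV.compl_outside.closed q hq.2).resolve_left fun h => h hq.1

/-- Were the next edge also inside, both inner edges would lie in `V`, since the vertex meets the
outside. Then `used_of_outside` would give a second chosen quadrant at the same crossing. -/
theorem IsMinimalLowerable.isExit_next [Fintype D] (hP : P.Connected)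
    (hV : IsMinimalLowerable x V) {q : D} (hq : IsEntry V q) : IsExit V (P.next q) := by
  refine ⟨hq.2, ?_⟩
  by_contra hn
  have mem : ∀ e, P.vertex q = P.vertex e → ¬ Outside V (P.edge e) → P.edge e ∈ V := by
    intro e he h
    by_contra h'
    exact h (.vertex hq.1 he h')
  exact (hV.used_of_isEntry hq).not_next (hV.used_of_outside hP (mem _ (by simp) hq.2)
    (mem (P.next (P.next q)) (by simp) hn) hq.1 (by simp))

theorem IsMinimalLowerable.outside_next_three [Fintype D] (hP : P.Connected)
    (hV : IsMinimalLowerable x V) {q : D} (hq : IsEntry V q) :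
    Outside V (P.edge (P.next (P.next (P.next q)))) := by
  by_contra hn
  exact (hV.used_of_isEntry hq).not_next_next
    (hV.used_of_isEntry ⟨(hV.isExit_next hP hq).2, hn⟩)

theorem IsMinimalLowerable.exists_isEntry [Fintype D] (hP : P.Connected)
    (hV : IsMinimalLowerable x V) {d : D} (hd : IsExit V d) :
    ∃ q, IsEntry V q ∧ P.next q = d := by
  have h₄ : ¬ Outside V (P.edge (P.next (P.next (P.next (P.next d))))) := by
    rw [P.next_four]
    exact hd.1
  by_cases h₂ : Outside V (P.edge (P.next (P.next d)))
  · by_cases h₃ : Outside V (P.edge (P.next (P.next (P.next d))))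
    · exact ⟨_, ⟨h₃, h₄⟩, P.next_four d⟩
    · exact (h₄ (hV.isExit_next hP ⟨h₂, h₃⟩).2).elim
  · exact (h₄ (hV.outside_next_three hP ⟨hd.2, h₂⟩)).elim

theorem IsEntry.exists_isExit [Fintype D] {q : D} (hq : IsEntry V q) :
    ∃ d, IsExit V d ∧ P.region d = P.region q := by
  by_contra! h
  exact mem_edge_of_region {e | ¬ Outside V e} (P.region q)
    (fun d hd h₁ h₂ => h d ⟨h₁, h₂⟩ hd) rfl hq.2 hq.1

/-- Entries are chosen, and a region has only one chosen quadrant. If that one avoids the filled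
set, the region has no entry, hence no exit, so its whole boundary lies inside, a contradiction. -/
theorem used_region_touches [Fintype D] (hP : P.Connected) (hV : IsMinimalLowerable x V) {q d : D}
    (hq : ¬ Outside V (P.edge q)) (hd : Used x d) (hdq : P.region d = P.region q) :
    ¬ Outside V (P.edge d) ∨ ¬ Outside V (P.nextEdge d) := by
  by_contra! hd'
  have noEntry : ∀ a, P.region a = P.region q → ¬ Outside V (P.nextEdge a) →
      ¬ Outside V (P.edge a) := by
    intro a ha h₁ h₂
    have := hd.eq_of_region (hV.used_of_isEntry ⟨h₂, h₁⟩) (hdq.trans ha.symm)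
    subst this
    exact h₁ hd'.2
  have key := map_eq_of_region_eq hP
    (φ := fun a => P.region a = P.region q → ¬ Outside V (P.edge a)) ?_ hdq.symm
  · exact key.mp (fun _ => hq) hdq hd'.1
  · intro a
    apply propext
    rw [P.region_faceNext]
    refine imp_congr_right fun ha => ?_
    have h₁ := noEntry (P.faceNext a) (by rwa [P.region_faceNext])
    have h₂ := mem_nextEdge_of_region {e | ¬ Outside V e} (P.region q) noEntry
      (q := P.faceNext a) (by rwa [P.region_faceNext])
    rw [nextEdge, next_faceNext, edge_flip] at h₁ h₂
    exact ⟨h₂, h₁⟩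

theorem sum_orthogonal' [Fintype D] (h : P.Edge → ℚ) (w : P.Vertex ⊕ Region → ℚ) :
    ∑ q, (h (P.nextEdge q) - h (P.edge q)) * (w (P.vend q) - w (P.rend q)) = 0 := by
  simpa only [mul_comm] using sum_orthogonal w h

theorem ncard_cells_compl_le [Fintype D] (hP : P.Connected) (hV : IsMinimalLowerable x V) :
    let W : Set P.Edge := {e | ¬ Outside V e}
    W.ncard + (dualTouching P.nextEdge P.edge P.vend P.rend W).ncard ≤
      (touching P.nextEdge P.edge W).ncard + 1 := by
  intro W
  have := P.finite_region
  refine ncard_add_ncard_le _ _ _ _ sum_orthogonal' W ?_ ?_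
  · intro w hw h i
    rw [edge_const hP w h i (P.edge P.mark)]
    exact hw _ fun h => h .mark
  · intro w hw
    obtain ⟨κ, hκ⟩ := hV.overlay_const_compl hP (w := w) fun q hq => hw q hq.symm
    have aux : ∀ j ∈ dualTouching P.nextEdge P.edge P.vend P.rend W, w j = κ := by
      rintro j ⟨q, hq, hj⟩
      have h₀ := hw q hq
      have h₁ : w (P.vend q) = κ := by
        rcases hq with hq | hq
        · have := (hκ _ hq).1
          rwa [vend, vertex_next] at this
        · exact (hκ _ hq).1
      rcases hj with rfl | rfl
      · exact h₁
      · exact h₀.symm.trans h₁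
    intro j hj j' hj'
    rw [aux j hj, aux j' hj']

theorem ncard_cells_outside_le [Fintype D] (hP : P.Connected) (hV : IsMinimalLowerable x V) :
    let O : Set P.Edge := {e | Outside V e}
    O.ncard + (dualTouching P.nextEdge P.edge P.vend P.rend O).ncard ≤
      (touching P.nextEdge P.edge O).ncard + 1 := by
  intro O
  have := P.finite_region
  refine ncard_add_ncard_le _ _ _ _ sum_orthogonal' O ?_ ?_
  · intro w hw h i
    obtain ⟨e, he⟩ := hV.nonempty
    rw [edge_const hP w h i e]
    exact hw _ fun h => hV.not_mem_of_outside h he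
  · intro w hw
    have hκ := fun d => overlay_const_outside (V := V) (w := w) (fun q hq => hw q hq.symm) (d := d)
    have aux : ∀ j ∈ dualTouching P.nextEdge P.edge P.vend P.rend O, w j = w (P.rend P.mark) := by
      rintro j ⟨q, hq, hj⟩
      have h₀ := hw q hq
      have h₁ : w (P.vend q) = w (P.rend P.mark) := by
        rcases hq with hq | hq
        · have := (hκ _ hq).1
          rwa [vend, vertex_next] at this
        · exact (hκ _ hq).1
      rcases hj with rfl | rfl
      · exact h₁
      · exact h₀.symm.trans h₁
    intro j hj j' hj'
    rw [aux j hj, aux j' hj']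

/-- The boundary of the complement of the outside passes through exactly two crossings. -/
theorem IsMinimalLowerable.ncard_isEntry [Fintype D] (hP : P.Connected)
    (hV : IsMinimalLowerable x V) : {q | IsEntry V q}.ncard = 2 := by
  classical
  have := P.finite_region
  have := Fintype.ofFinite Region
  have := Fintype.ofFinite P.Vertex
  let W : Set P.Edge := {e | ¬ Outside V e}
  let O : Set P.Edge := {e | Outside V e}
  let K : Set D := {q | IsEntry V q}
  let JW := dualTouching P.nextEdge P.edge P.vend P.rend W
  let JO := dualTouching P.nextEdge P.edge P.vend P.rend O
  let TV : Set P.Vertex := {v | ∃ d, P.vertex d = v ∧ ¬ Outside V (P.edge d)}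
  let TR : Set Region := {r | ∃ d, P.region d = r ∧ ¬ Outside V (P.edge d)}
  let U : Set D := {d | P.vertex d ∈ TV ∧ Used x d}
  have hUTV : ∀ d, (¬ Outside V (P.edge d) ∨ ¬ Outside V (P.nextEdge d)) → P.vertex d ∈ TV := by
    rintro d (h | h)
    · exact ⟨d, rfl, h⟩
    · exact ⟨P.next d, vertex_next d, h⟩
  -- the behaviour at a crossing, seen from its chosen quadrant
  have pattern : ∀ d, P.vertex d ∈ TV → Used x d →
      (IsEntry V d ∧ Outside V (P.edge (P.next (P.next d))) ∧
        Outside V (P.edge (P.next (P.next (P.next d))))) ∨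
      (¬ Outside V (P.edge d) ∧ ¬ Outside V (P.edge (P.next d)) ∧
        ¬ Outside V (P.edge (P.next (P.next d))) ∧
        ¬ Outside V (P.edge (P.next (P.next (P.next d))))) := by
    rintro d ⟨d', hd', hO⟩ hu
    by_cases hd : IsEntry V d
    · exact Or.inl ⟨hd, (hV.isExit_next hP hd).2, hV.outside_next_three hP hd⟩
    · right
      have no : ∀ e, P.vertex e = P.vertex d → ¬ Outside V (P.edge (P.next e)) →
          ¬ Outside V (P.edge e) := by
        intro e he h h'
        have := (hV.used_of_isEntry (q := e) ⟨h', h⟩).eq_of_vertex hu he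
        exact hd (this ▸ ⟨h', h⟩)
      have n₀ := no d rfl
      have n₁ := no (P.next d) (by simp)
      have n₂ := no (P.next (P.next d)) (by simp)
      have n₃ := no (P.next (P.next (P.next d))) (by simp)
      rw [P.next_four] at n₃
      rcases eq_of_vertex_eq hd' with rfl | rfl | rfl | rfl <;> tauto
  -- the number of chosen quadrants
  have hUR : P.region '' U = TR := by
    apply Set.Subset.antisymm
    · rintro _ ⟨d, ⟨hd, hu⟩, rfl⟩
      rcases pattern d hd hu with h | h
      · exact ⟨P.flip (P.next d), by rw [← P.region_faceNext, faceNext_flip_next],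
          by rw [edge_flip]; exact h.1.2⟩
      · exact ⟨d, rfl, h.1⟩
    · rintro _ ⟨q, rfl, hq⟩
      obtain ⟨d, hu, hd⟩ := exists_used_region x (hV.compl_outside.inner q hq)
      exact ⟨d, ⟨hUTV d (used_region_touches hP hV hq hu hd), hu⟩, hd⟩
  have hU : U.ncard = TR.ncard := by
    rw [← hUR]
    exact (Set.InjOn.ncard_image fun a ha b hb h => ha.2.eq_of_region hb.2 h).symm
  -- the cells incident with `W`
  have hJW : JW.ncard = TV.ncard + TR.ncard := by
    rw [← Set.ncard_image_of_injective TV (Sum.inl_injective (β := Region)),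
      ← Set.ncard_image_of_injective TR (Sum.inr_injective (α := P.Vertex)),
      ← Set.ncard_union_eq]
    · congr 1
      ext i
      constructor
      · rintro ⟨q, hq, rfl | rfl⟩
        · exact Or.inl ⟨_, hUTV q hq.symm, rfl⟩
        · refine Or.inr ⟨_, ?_, rfl⟩
          rcases hq with hq | hq
          · exact ⟨P.flip (P.next q), by rw [← P.region_faceNext, faceNext_flip_next],
              by rw [edge_flip]; exact hq⟩
          · exact ⟨q, rfl, hq⟩
      · rintro (⟨_, ⟨d, rfl, hd⟩, rfl⟩ | ⟨_, ⟨d, rfl, hd⟩, rfl⟩)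
        · exact ⟨d, Or.inr hd, Or.inl rfl⟩
        · exact ⟨d, Or.inr hd, Or.inr rfl⟩
    · rw [Set.disjoint_left]
      rintro _ ⟨v, -, rfl⟩ ⟨r, -, h⟩
      cases h
  -- Every cell meets `O` or `W`, and each entry contributes its vertex and its region to both;
  -- these are distinct for distinct entries.
  have hJ : Nat.card (P.Vertex ⊕ Region) + 2 * K.ncard ≤ JO.ncard + JW.ncard := by
    rw [← Set.ncard_union_add_ncard_inter JO JW, ← Set.ncard_univ]
    refine add_le_add (Set.ncard_le_ncard ?_) ?_
    · have aux : ∀ q : D, ∀ i, (i = P.vend q ∨ i = P.rend q) → i ∈ JO ∪ JW := by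
        intro q i hi
        by_cases h : Outside V (P.edge q)
        · exact Or.inl ⟨q, Or.inr h, hi⟩
        · exact Or.inr ⟨q, Or.inr h, hi⟩
      rintro (v | r) -
      · obtain ⟨q, rfl⟩ := P.vertex_surjective v
        exact aux q _ (Or.inl rfl)
      · obtain ⟨q, rfl⟩ := P.region_surjective r
        exact aux q _ (Or.inr rfl)
    · have h₁ : (P.vend '' K).ncard = K.ncard := Set.InjOn.ncard_image fun a ha b hb h =>
        (hV.used_of_isEntry ha).eq_of_vertex (hV.used_of_isEntry hb) (Sum.inl_injective h)
      have h₂ : (P.rend '' K).ncard = K.ncard := Set.InjOn.ncard_image fun a ha b hb h =>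
        (hV.used_of_isEntry ha).eq_of_region (hV.used_of_isEntry hb) (Sum.inr_injective h)
      have h₃ : (P.vend '' K ∪ P.rend '' K).ncard = 2 * K.ncard := by
        rw [Set.ncard_union_eq, h₁, h₂, two_mul]
        rw [Set.disjoint_left]
        rintro _ ⟨v, -, rfl⟩ ⟨r, -, h⟩
        cases h
      rw [← h₃]
      refine Set.ncard_le_ncard ?_ (Set.toFinite _)
      rintro _ (⟨q, hq, rfl⟩ | ⟨q, hq, rfl⟩)
      · exact ⟨⟨q, Or.inr hq.1, Or.inl rfl⟩, ⟨q, Or.inl hq.2, Or.inl rfl⟩⟩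
      · exact ⟨⟨q, Or.inr hq.1, Or.inr rfl⟩, ⟨q, Or.inl hq.2, Or.inr rfl⟩⟩
  -- the quadrants incident with `W` and with its complement
  have hQW : (touching P.nextEdge P.edge W).ncard = 2 * W.ncard + K.ncard := by
    rw [← ncard_edge_preimage, ← Set.ncard_union_eq]
    · congr 1
      ext q
      simp only [touching, W, K, IsEntry, Set.mem_ofPred_eq, Set.mem_union, Set.mem_preimage]
      tauto
    · rw [Set.disjoint_left]
      exact fun q hq h => hq h.1
  have hKexit : {q : D | IsExit V q}.ncard = K.ncard := by
    rw [← Set.ncard_image_of_injective K P.next.injective]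
    congr 1
    ext d
    constructor
    · exact hV.exists_isEntry hP
    · rintro ⟨q, hq, rfl⟩
      exact hV.isExit_next hP hq
  have hQO : (touching P.nextEdge P.edge O).ncard = 2 * O.ncard + K.ncard := by
    rw [← ncard_edge_preimage, ← hKexit, ← Set.ncard_union_eq]
    · congr 1
      ext q
      simp only [touching, O, IsExit, Set.mem_ofPred_eq, Set.mem_union, Set.mem_preimage]
      tauto
    · rw [Set.disjoint_left]
      exact fun q hq h => h.1 hq
  have hWO : O.ncard + W.ncard = Nat.card P.Edge := Set.ncard_add_ncard_compl O
  -- the darts of `W`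
  have hsum := sum_vertex_two x (fun d => (if ¬ Outside V (P.edge d) then 1 else 0) -
    2 * (if Used x d then 1 else 0) + 3 * (if IsEntry V d then 1 else 0)) TV ?_ ?_
  rotate_left
  · intro d hd h
    have e₁ : ¬ IsEntry V (P.next d) := fun h' => h.not_next (hV.used_of_isEntry h')
    have e₂ : ¬ IsEntry V (P.next (P.next d)) := fun h' => h.not_next_next (hV.used_of_isEntry h')
    have e₃ : ¬ IsEntry V (P.next (P.next (P.next d))) :=
      fun h' => h.not_next_next_next (hV.used_of_isEntry h')
    rw [if_pos h, if_neg h.not_next, if_neg h.not_next_next, if_neg h.not_next_next_next,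
      if_neg e₁, if_neg e₂, if_neg e₃]
    rcases pattern d hd h with ⟨h₁, h₂, h₃⟩ | ⟨h₁, h₂, h₃, h₄⟩
    · rw [if_neg (not_not.2 h₁.1), if_pos (show ¬ Outside V (P.edge (P.next d)) from h₁.2),
        if_neg (not_not.2 h₂), if_neg (not_not.2 h₃), if_pos h₁]
      norm_num
    · rw [if_pos h₁, if_pos h₂, if_pos h₃, if_pos h₄, if_neg fun h => h₁ h.1]
      norm_num
  · rintro d ⟨d', hd', hO⟩ hc
    have u₁ : ¬ Used x d := fun h => hc h.isCrossing
    have u₂ : ¬ Used x (P.next d) := fun h => hc (by simpa using h.isCrossing)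
    have e₁ : ¬ IsEntry V d := fun h => u₁ (hV.used_of_isEntry h)
    have e₂ : ¬ IsEntry V (P.next d) := fun h => u₂ (hV.used_of_isEntry h)
    rw [if_neg u₁, if_neg u₂, if_neg e₁, if_neg e₂]
    have hcc := next_next_of_not_isCrossing hc
    have key : ¬ Outside V (P.edge d) ∧ ¬ Outside V (P.edge (P.next d)) := by
      simp only [IsEntry, nextEdge] at e₁ e₂
      rw [hcc] at e₂
      have := eq_of_vertex_eq hd'
      rw [hcc] at this
      rcases this with rfl | rfl | rfl | rfl <;> tauto
    rw [if_pos key.1, if_pos key.2]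
    norm_num
  rw [Finset.sum_add_distrib, Finset.sum_sub_distrib, ← Finset.mul_sum, ← Finset.mul_sum,
    Finset.sum_boole, Finset.sum_boole, Finset.sum_boole] at hsum
  have s₁ : ((Finset.univ.filter fun d => P.vertex d ∈ TV).filter
      fun d => ¬ Outside V (P.edge d)).card = 2 * W.ncard := by
    rw [← ncard_edge_preimage, Set.ncard_eq_toFinset_card', Finset.filter_filter]
    congr 1
    ext d
    simp only [Finset.mem_filter, Finset.mem_univ, true_and, Set.mem_toFinset, Set.mem_preimage]
    exact ⟨fun h => h.2, fun h => ⟨hUTV d (Or.inl h), h⟩⟩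
  have s₂ : ((Finset.univ.filter fun d => P.vertex d ∈ TV).filter
      fun d => Used x d).card = U.ncard := by
    rw [Set.ncard_eq_toFinset_card', Finset.filter_filter]
    congr 1
    ext d
    simp [U]
  have s₃ : ((Finset.univ.filter fun d => P.vertex d ∈ TV).filter
      fun d => IsEntry V d).card = K.ncard := by
    rw [Set.ncard_eq_toFinset_card', Finset.filter_filter]
    congr 1
    ext d
    simp only [Finset.mem_filter, Finset.mem_univ, true_and, Set.mem_toFinset]
    exact ⟨fun h => h.2, fun h => ⟨hUTV d (Or.inr h.2), h⟩⟩
  rw [s₁, s₂, s₃] at hsum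
  have L₁ : W.ncard + JW.ncard ≤ _ := ncard_cells_compl_le hP hV
  have L₂ : O.ncard + JO.ncard ≤ _ := ncard_cells_outside_le hP hV
  have hcells := P.card_cells hP
  have hd := P.card_dart
  change K.ncard = 2
  change _ ≤ (touching P.nextEdge P.edge W).ncard + 1 at L₁
  change _ ≤ (touching P.nextEdge P.edge O).ncard + 1 at L₂
  -- Now `2|W| + 3|K| = 2|JW|`. With this, `L₁` yields `|K| ≤ 2`, while `L₂`, `hJ` and Euler's
  -- formula yield `|K| ≥ 2`.
  omega

/-! ### The lowered state -/

open Classical in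
/-- The choice of quadrants after lowering the height function inside `V` and its holes. -/
noncomputable def lowerQuadrant (x : P.KauffmanState) (V : Set P.Edge) (c : P.Crossing) : D :=
  if IsEntry V (x.quadrant c) then P.next (x.quadrant c) else x.quadrant c

/-- A region that loses its chosen quadrant at an entry also contains an exit, and every exit
receives the quadrant of the entry preceding it. -/
theorem surjOn_lowerQuadrant [Fintype D] (hP : P.Connected) (hV : IsMinimalLowerable x V) :
    Set.SurjOn (fun c => P.region (lowerQuadrant x V c)) Set.univ {r | ¬ P.Distinguished r} := by
  intro r hr
  obtain ⟨c, -, hc⟩ := x.bijOn.surjOn hr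
  by_cases h : IsEntry V (x.quadrant c)
  · obtain ⟨d, hd, hdr⟩ := h.exists_isExit
    obtain ⟨q, hq, rfl⟩ := hV.exists_isEntry hP hd
    obtain ⟨c', rfl⟩ := hV.used_of_isEntry hq
    refine ⟨c', Set.mem_univ _, ?_⟩
    simp only [lowerQuadrant, if_pos hq]
    exact hdr.trans hc
  · refine ⟨c, Set.mem_univ _, ?_⟩
    simp only [lowerQuadrant, if_neg h]
    exact hc

theorem mapsTo_lowerQuadrant (hV : IsMinimalLowerable x V) :
    Set.MapsTo (fun c => P.region (lowerQuadrant x V c)) Set.univ {r | ¬ P.Distinguished r} := by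
  intro c _
  by_cases h : IsEntry V (x.quadrant c)
  · simp only [lowerQuadrant, if_pos h]
    exact hV.compl_outside.inner _ h.2
  · simp only [lowerQuadrant, if_neg h]
    exact x.bijOn.mapsTo (Set.mem_univ c)

/-- The state obtained by lowering the height function inside `V` and its holes. -/
noncomputable def IsMinimalLowerable.lower [Fintype D] (hP : P.Connected)
    (hV : IsMinimalLowerable x V) : P.KauffmanState where
  quadrant := lowerQuadrant x V
  vertex_quadrant c := by
    unfold lowerQuadrant
    split_ifs <;> simp [x.vertex_quadrant]
  bijOn := by
    refine ⟨mapsTo_lowerQuadrant hV, ?_, surjOn_lowerQuadrant hP hV⟩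
    -- Injectivity is a count: the old and the new choice have the same finite image, and the old
    -- one is injective.
    refine Set.injOn_of_ncard_image_eq ?_ (Set.toFinite _)
    rw [(surjOn_lowerQuadrant hP hV).image_eq_of_mapsTo (mapsTo_lowerQuadrant hV),
      ← x.bijOn.image_eq, x.bijOn.injOn.ncard_image]

theorem IsMinimalLowerable.quadrant_lower_of_isEntry [Fintype D] (hP : P.Connected)
    (hV : IsMinimalLowerable x V) {c : P.Crossing} (h : IsEntry V (x.quadrant c)) :
    (hV.lower hP).quadrant c = P.next (x.quadrant c) := if_pos h

theorem IsMinimalLowerable.quadrant_lower_of_not [Fintype D] (hP : P.Connected)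
    (hV : IsMinimalLowerable x V) {c : P.Crossing} (h : ¬ IsEntry V (x.quadrant c)) :
    (hV.lower hP).quadrant c = x.quadrant c := if_neg h

/-! ### Lowering as a well-founded clock move -/

/-- `y` is obtained from `x` by lowering the height function somewhere and raising it nowhere. -/
def Below (y x : P.KauffmanState) : Prop :=
  ∃ g : P.Edge → ℚ, (∀ e, 0 ≤ g e) ∧ (∃ e, g e ≠ 0) ∧ g (P.edge P.mark) = 0 ∧
    ∀ d, chosen y d = chosen x d + g (P.edge d) - g (P.nextEdge d)

theorem Below.trans {x y z : P.KauffmanState} (h : Below x y) (h' : Below y z) : Below x z := by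
  obtain ⟨g, h₁, ⟨e, h₂⟩, h₃, h₄⟩ := h
  obtain ⟨g', h₁', -, h₃', h₄'⟩ := h'
  refine ⟨g + g', fun e => add_nonneg (h₁ e) (h₁' e), ⟨e, ?_⟩, by simp [h₃, h₃'], fun d => ?_⟩
  · exact (add_pos_of_pos_of_nonneg (lt_of_le_of_ne (h₁ e) h₂.symm) (h₁' e)).ne'
  · rw [h₄, h₄', Pi.add_apply, Pi.add_apply]
    ring

theorem not_below_self (hP : P.Connected) (x : P.KauffmanState) : ¬ Below x x := by
  rintro ⟨g, -, ⟨e, h₂⟩, h₃, h₄⟩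
  apply h₂
  rw [← h₃]
  exact edge_const hP g (fun q => by linarith [h₄ q]) _ _

theorem wellFounded_below [Finite D] (hP : P.Connected) :
    WellFounded (Below (P := P)) := by
  have := finite_state (P := P)
  have : IsTrans P.KauffmanState Below := ⟨fun _ _ _ => Below.trans⟩
  have : Std.Irrefl (α := P.KauffmanState) Below := ⟨not_below_self hP⟩
  exact Finite.wellFounded_of_trans_of_irrefl _

theorem IsMinimalLowerable.below_lower [Fintype D] (hP : P.Connected)
    (hV : IsMinimalLowerable x V) : Below (hV.lower hP) x := by
  classical
  obtain ⟨e, he⟩ := hV.nonempty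
  refine ⟨fun e => if Outside V e then 0 else 1, fun e => by dsimp only; split_ifs <;> norm_num,
    ⟨e, by simp [show ¬ Outside V e from fun h => hV.not_mem_of_outside h he]⟩,
    if_pos .mark, fun d => ?_⟩
  beta_reduce
  by_cases h₁ : IsEntry V d
  · have hu := hV.used_of_isEntry h₁
    have hn : ¬ Used (hV.lower hP) d := by
      rintro ⟨c, hc⟩
      have hxc : x.quadrant c = d := (used_quadrant x c).eq_of_vertex hu (by
        rw [x.vertex_quadrant, ← hc, (hV.lower hP).vertex_quadrant])
      rw [hV.quadrant_lower_of_isEntry hP (by rwa [hxc]), hxc] at hc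
      exact P.next_ne d hc
    rw [chosen_eq_zero hn, hu.chosen_eq, if_pos h₁.1, if_neg h₁.2]
    norm_num
  by_cases h₂ : IsExit V d
  · obtain ⟨q, hq, rfl⟩ := hV.exists_isEntry hP h₂
    have hu := hV.used_of_isEntry hq
    have hu' : Used (hV.lower hP) (P.next q) := by
      obtain ⟨c, rfl⟩ := hu
      exact ⟨c, hV.quadrant_lower_of_isEntry hP hq⟩
    rw [hu'.chosen_eq, chosen_eq_zero hu.not_next, if_neg h₂.1, if_pos h₂.2]
    norm_num
  · have hiff : Used (hV.lower hP) d ↔ Used x d := by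
      constructor
      · rintro ⟨c, hc⟩
        by_cases h : IsEntry V (x.quadrant c)
        · rw [hV.quadrant_lower_of_isEntry hP h] at hc
          exact (h₂ (hc ▸ hV.isExit_next hP h)).elim
        · rw [hV.quadrant_lower_of_not hP h] at hc
          exact ⟨c, hc⟩
      · rintro ⟨c, rfl⟩
        exact ⟨c, hV.quadrant_lower_of_not hP h₁⟩
    have hO : Outside V (P.edge d) ↔ Outside V (P.nextEdge d) := by
      simp only [IsEntry, IsExit] at h₁ h₂
      tauto
    simp only [chosen, hiff, hO]
    ring

/-- Edges of `V` are free, and the rotations that link them keep the vertex fixed. -/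
theorem IsMinimalLowerable.freeEdge_path (hV : IsMinimalLowerable x V)
    {d d' : D} (hd : P.edge d ∈ V) (hd' : P.edge d' ∈ V) :
    Relation.ReflTransGen P.FreeEdge (P.vertex d) (P.vertex d') := by
  have free : ∀ a, P.edge a ∈ V → P.FreeEdge (P.vertex a) (P.vertex (P.flip a)) := fun a ha =>
    ⟨a, rfl, rfl, hV.inner a ha, hV.inner _ (by rwa [edge_flip])⟩
  refine hV.induction (p := fun e => ∀ d', P.edge d' = e →
    Relation.ReflTransGen P.FreeEdge (P.vertex d) (P.vertex d')) hd ?_ ?_ hd' d' rfl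
  · intro a ha
    rcases eq_of_edge_eq ha with rfl | rfl
    · exact .refl
    · exact .single (free d hd)
  · intro a ha _ _ ih b hb
    have h := ih (P.next a) rfl
    rw [vertex_next] at h
    rcases eq_of_edge_eq hb with rfl | rfl
    · exact h
    · exact h.tail (free a ha)

theorem IsMinimalLowerable.clockMove_lower [Fintype D] (hP : P.Connected)
    (hV : IsMinimalLowerable x V) : ClockMove x (hV.lower hP) := by
  obtain ⟨q₁, q₂, hne, hK⟩ := Set.ncard_eq_two.1 (hV.ncard_isEntry hP)
  have mem : ∀ q, IsEntry V q ↔ q = q₁ ∨ q = q₂ := fun q => Set.ext_iff.1 hK q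
  have h₁ := (mem q₁).2 (Or.inl rfl)
  have h₂ := (mem q₂).2 (Or.inr rfl)
  have inV : ∀ q, IsEntry V q → P.edge (P.next q) ∈ V := by
    intro q hq
    by_contra h
    exact hq.2 (.vertex hq.1 (vertex_next q).symm h)
  have path := hV.freeEdge_path (inV _ h₁) (inV _ h₂)
  obtain ⟨c₁, rfl⟩ := hV.used_of_isEntry h₁
  obtain ⟨c₂, rfl⟩ := hV.used_of_isEntry h₂
  refine ⟨c₁, c₂, fun h => hne (by rw [h]), ?_, ?_, fun c hc₁ hc₂ => ?_, ?_⟩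
  · rw [hV.quadrant_lower_of_isEntry hP h₁]
    exact (P.next_ne _).symm
  · rw [hV.quadrant_lower_of_isEntry hP h₂]
    exact (P.next_ne _).symm
  · rw [hV.quadrant_lower_of_not hP]
    rw [mem]
    rintro (h | h)
    · exact hc₁ (quadrant_injective x h)
    · exact hc₂ (quadrant_injective x h)
  · simpa only [vertex_next, x.vertex_quadrant] using path

/-- Lowering preserves the states of type `C`-NW. -/
theorem IsMinimalLowerable.lower_mem_typeNW [Fintype D] (hP : P.Connected)
    (hV : IsMinimalLowerable x V) {C : Set P.Crossing} (L : P.toProjection.Labelling C)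
    (hL : ∀ c : C, P.Distinguished (P.region (L.south c))) (hx : x ∈ typeNW L) :
    hV.lower hP ∈ typeNW L := by
  intro c
  by_cases h : IsEntry V (x.quadrant c)
  · right
    rw [hV.quadrant_lower_of_isEntry hP h]
    rcases hx c with hc | hc
    · rw [hc]
      rfl
    · exfalso
      apply h.2
      rw [hc, nextEdge, Labelling.west, P.next_four]
      exact hV.outside_of_distinguished (hL c)
  · rw [hV.quadrant_lower_of_not hP h]
    exact hx c

theorem ClockMove.symm {x y : P.KauffmanState} (h : ClockMove x y) : ClockMove y x := by
  obtain ⟨c₁, c₂, h₀, h₁, h₂, h₃, h₄⟩ := h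
  refine ⟨c₂, c₁, h₀.symm, h₂.symm, h₁.symm, fun c hc hc' => (h₃ c hc' hc).symm, ?_⟩
  have : Std.Symm P.FreeEdge := ⟨by
    rintro a b ⟨d, ha, hb, h, h'⟩
    exact ⟨P.flip d, hb, by rwa [P.flip_flip], h', by rwa [P.flip_flip]⟩⟩
  exact Std.Symm.symm _ _ h₄

/-! ### Uniqueness of the lowest state -/

/-- If the maximum of `h` exceeded its value at the mark, the top level set would be lowerable for
`x`. It avoids distinguished regions, along whose boundaries `h` keeps the value at the mark; and a
counterclockwise rotation can raise `h` only across a quadrant chosen in `x`. -/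
theorem height_le_mark [Fintype D] (hP : P.Connected) {x y : P.KauffmanState}
    (hx : ∀ V, ¬ IsLowerable x V) {h : P.Edge → ℚ}
    (hh : ∀ q, h (P.nextEdge q) - h (P.edge q) = chosen x q - chosen y q) (e : P.Edge) :
    h e ≤ h (P.edge P.mark) := by
  by_contra! hlt
  have : Nonempty P.Edge := ⟨e⟩
  obtain ⟨m, hm⟩ := Finite.exists_max h
  refine hx {e | h e = h m} ⟨⟨m, rfl⟩, ?_, ?_⟩
  · intro d hd hdist
    have const : ∀ a, P.region d = P.region a → h (P.edge d) = h (P.edge a) := by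
      intro a ha
      have key := map_eq_of_region_eq hP
        (φ := fun b => P.Distinguished (P.region b) → h (P.edge d) = h (P.edge b)) ?_ ha
      · exact key.mp (fun _ => rfl) (ha ▸ hdist)
      · intro b
        apply propext
        rw [P.region_faceNext]
        refine imp_congr_right fun hb => ?_
        have hb' : P.Distinguished (P.region (P.faceNext b)) := by rwa [P.region_faceNext]
        have := hh (P.faceNext b)
        rw [chosen_eq_zero fun h => h.not_distinguished hb',
          chosen_eq_zero fun h => h.not_distinguished hb', nextEdge, next_faceNext,
          edge_flip] at this
        rw [show h (P.edge (P.faceNext b)) = h (P.edge b) by linarith]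
    have hd : h (P.edge d) = h m := hd
    have hdm : h (P.edge d) = h (P.edge P.mark) := by
      rcases hdist with hdist | hdist
      · exact const _ hdist
      · rw [const _ hdist, edge_flip]
    have := hm e
    linarith
  · intro d hd
    have hd : h (P.nextEdge d) = h m := hd
    by_cases hu : Used x d
    · exact Or.inr hu
    · left
      change h (P.edge d) = h m
      have h₁ := hh d
      have h₂ := hm (P.edge d)
      have h₃ : 0 ≤ chosen y d := by
        unfold chosen
        split_ifs <;> norm_num
      rw [chosen_eq_zero hu] at h₁
      linarith

/-- The bound applied to `h` and to `-h` makes the height difference constant. -/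
theorem eq_of_not_isLowerable [Fintype D] (hP : P.Connected) {x y : P.KauffmanState}
    (hx : ∀ V, ¬ IsLowerable x V) (hy : ∀ V, ¬ IsLowerable y V) : x = y := by
  obtain ⟨h, hh⟩ := exists_height hP x y
  have h₁ := height_le_mark hP hx hh
  have h₂ := height_le_mark hP hy (h := -h) (y := x) fun q => by
    simp only [Pi.neg_apply]
    linarith [hh q]
  have h₃ : ∀ e, h e = h (P.edge P.mark) := fun e =>
    le_antisymm (h₁ e) (neg_le_neg_iff.1 (h₂ e))
  refine ext_of_chosen fun d => ?_
  have := hh d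
  rw [h₃ (P.edge d), h₃ (P.nextEdge d), sub_self] at this
  linarith

theorem exists_path_to_lowest [Fintype D] (hP : P.Connected) {S : Set P.KauffmanState}
    (hS : ∀ x ∈ S, ∀ V, ∀ hV : IsMinimalLowerable x V, hV.lower hP ∈ S)
    (x : P.KauffmanState) (hx : x ∈ S) :
    ∃ m, (∀ V, ¬ IsLowerable m V) ∧
      Relation.ReflTransGen (fun a b => a ∈ S ∧ b ∈ S ∧ ClockMove a b) x m := by
  induction x using (wellFounded_below hP).induction with
  | _ x ih =>
    by_cases h : ∃ V, IsLowerable x V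
    · obtain ⟨V', hV'⟩ := h
      obtain ⟨V, hV⟩ := exists_isMinimalLowerable hV'
      have hmem := hS x hx V hV
      obtain ⟨m, hm, hpath⟩ := ih _ (hV.below_lower hP) hmem
      exact ⟨m, hm, .head ⟨hx, hmem, hV.clockMove_lower hP⟩ hpath⟩
    · push Not at h
      exact ⟨x, h, .refl⟩

/-- A set of states that is closed under lowering is clock-connected. -/
theorem clockConnected_of_lower_mem [Fintype D] (hP : P.Connected) {S : Set P.KauffmanState}
    (hS : ∀ x ∈ S, ∀ V, ∀ hV : IsMinimalLowerable x V, hV.lower hP ∈ S) : ClockConnected S := by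
  intro x hx y hy
  obtain ⟨m, hm, hxm⟩ := exists_path_to_lowest hP hS x hx
  obtain ⟨n, hn, hyn⟩ := exists_path_to_lowest hP hS y hy
  obtain rfl := eq_of_not_isLowerable hP hm hn
  have : Std.Symm fun a b : P.KauffmanState => a ∈ S ∧ b ∈ S ∧ ClockMove a b :=
    ⟨fun a b h => ⟨h.2.1, h.1, h.2.2.symm⟩⟩
  exact hxm.trans (Std.Symm.symm _ _ hyn)

end MarkedDiagram

end PlanarClock

/-- Let `C` be a set of crossings of a marked planar diagram `P`, all adjacent to one distinguished
region `R`, with the quadrants at each `c ∈ C` labelled so that the one labelled `S` lies in `R`.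
If the `NS` resolution of `P` at all of `C` is connected, then the set of Kauffman states of type
`C`-NW is clock-connected. -/
theorem mainTheorem11 {D : Type u} {Region : Type v} [Finite D]
    (P : PlanarClock.MarkedDiagram D Region) (R : Region) (hR : P.Distinguished R)
    (C : Set P.Crossing) (L : P.toProjection.Labelling C)
    (hL : ∀ c : C, P.region (L.south c) = R)
    (hconn : L.nsResolution.Connected) :
    PlanarClock.MarkedDiagram.ClockConnected (PlanarClock.MarkedDiagram.typeNW L) := by
  have := Fintype.ofFinite D
  have hP := L.connected_of_nsResolution hconn
  exact PlanarClock.MarkedDiagram.clockConnected_of_lower_mem hP fun x hx V hV =>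
    hV.lower_mem_typeNW hP L (fun c => by rwa [hL c]) hx
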